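/- **Setting.** Let $N\ge 1$ and consider a chain of subsystems $i=1,\dots,N$ on $x\in[0,1]$, $$\partial_t u_i+\Lambda_i^+\partial_x u_i=\Sigma_i^{++}u_i+\Sigma_i^{+-}v_i,\qquad \partial_t v_i-\Lambda_i^-\partial_x v_i=\Sigma_i^{-+}u_i+\Sigma_i^{--}v_i,$$ $$u_i(t,0)=Q_{i,i}v_i(t,0)+Q_{i,i-1}u_{i-1}(t,1),\qquad v_i(t,1)=R_{i,i}u_i(t,1)+R_{i,i+1}v_{i+1}(t,0),$$ with $u_i\in\mathbb R^{n_i}$, $v_i\in\mathbb R^{m_i}$, $n_i,m_i\ge1$, $\Lambda_i^+=\mathrm{diag}(\lambda_i^j)$, $\Lambda_i^-=\mathrm{diag}(\mu_i^j)$, $0<\lambda_i^1<\dots<\lambda_i^{n_i}$, $0<\mu_i^1<\dots<\mu_i^{m_i}$, $\Sigma_i$ continuous in $x$ with zero diagonal, $Q,R$ constant. Put $\Lambda_i=\mathrm{diag}(\Lambda_i^+,-\Lambda_i^-)$ and $\Sigma_i=\left(\begin{smallmatrix}\Sigma_i^{++}&\Sigma_i^{+-}\\ \Sigma_i^{-+}&\Sigma_i^{--}\end{smallmatrix}\right)$.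 Let $K_i=\left(\begin{smallmatrix}K_i^{uu}&K_i^{uv}\\K_i^{vu}&K_i^{vv}\end{smallmatrix}\right)$ on $\{0\le x\le y\le 1\}$ and $F_i$ on $\{0\le x\le1,\ 0\le y\le x/\lambda_i^1\}$ be bounded Borel backstepping kernels, that is, solutions (along characteristics; the boundary conditions are not imposed at corners) of $$\Lambda_i\partial_xK_i+\partial_yK_i\Lambda_i=-K_i\Sigma_i(y)+\mathrm{diag}(G_i(x),0)K_i,\quad \Lambda_iK_i(x,x)-K_i(x,x)\Lambda_i=\Sigma_i(x)-\mathrm{diag}(G_i(x),0),$$ $$K_i^{uu}(x,1)\Lambda_i^+=K_i^{uv}(x,1)\Lambda_i^-R_{i,i},$$ $$\Lambda_i^+\partial_xF_i+\partial_yF_i=G_i(x)F_i,\quad F_i(x,0)=-K_i^{uv}(x,1)\Lambda_i^-R_{i,i+1},\quad (F_i(x,x/\lambda_i^1))_{k\ell}=0\ (k>1),$$ where $G_i$ is strictly upper triangular, $(G_i(x))_{k\ell}=(\Sigma_i^{++}(x))_{k\ell}+(\lambda_i^\ell-\lambda_i^k)(K_i^{uu}(x,x))_{k\ell}$ for $k<\ell$.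 Set $\bar G_i(x)=K_i^{vv}(x,1)\Lambda_i^-R_{i,i}-K_i^{vu}(x,1)\Lambda_i^+$, $\bar f_i(x)=K_i^{vv}(x,1)\Lambda_i^-R_{i,i+1}$, $D_i=\sum_{j<i}1/\lambda_j^1$, and $h_i=1/\lambda_{i-1}^1$ if $i\ge2$, $h_1=0$. Fix $1\le i\le N-1$. A *trajectory of subsystem $i$ from time $t_0$*, with virtual input $\hat U_i$ (whose delayed value $\hat U_i(t-D_i)$ represents the upstream term $Q_{i,i-1}\alpha_{i-1}(t,1)$) and downstream signal $v_{i+1}(\cdot,0)$, consists of Borel, locally bounded functions $u_i,v_i,\alpha_i,\beta_i$ such that, for $t\ge t_0$ (boundary conditions: for $t>t_0$), $$\alpha_i(t,x)=u_i(t,x)+\int_0^{x/\lambda_i^1}F_i(x,y)v_{i+1}(t-y,0)\,dy+\int_x^1\big(K_i^{uu}(x,y)u_i(t,y)+K_i^{uv}(x,y)v_i(t,y)\big)dy,$$ $$\beta_i(t,x)=v_i(t,x)+\int_x^1\big(K_i^{vu}(x,y)u_i(t,y)+K_i^{vv}(x,y)v_i(t,y)\big)dy,$$ $$\partial_t\alpha_i+\Lambda_i^+\partial_x\alpha_i=G_i(x)\alpha_i,\qquad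 \partial_t\beta_i-\Lambda_i^-\partial_x\beta_i=\bar G_i(x)\,\omega_i(t)+\bar f_i(x)v_{i+1}(t,0),$$ $$\alpha_i(t,0)=Q_{i,i}v_i(t,0)+\hat U_i(t-D_i)+\int_0^1\big(K_i^{uu}(0,y)u_i(t,y)+K_i^{uv}(0,y)v_i(t,y)\big)dy-Q_{i,i-1}\int_0^{h_i}F_{i-1}(1,y)v_i(t-y,0)\,dy,$$ $$\beta_i(t,1)=R_{i,i}\,\omega_i(t)+R_{i,i+1}v_{i+1}(t,0),\qquad \omega_i(t)=\alpha_i(t,1)-\int_0^{1/\lambda_i^1}F_i(1,y)v_{i+1}(t-y,0)\,dy,$$ the transport equations being integrated along all characteristics, and $Q_{1,0}F_0=0$. Predictor functions $P_{u_i},P_{v_i},P_{\alpha_i},P_{\beta_i}$ are *exact after $t_0$* if $P_{u_i}(t,x)=u_i(t+D_i,x)$, and likewise for $v_i,\alpha_i,\beta_i$, for all $t>t_0$ and $x\in[0,1]$. **Statement.** There is a control law, depending only on the system, the kernels and $i$, $$\hat U_i(t)=\mathcal F[\zeta_i](t)+\mathcal B[P_{u_i},P_{v_i},P_{\alpha_i},P_{\beta_i}](t),$$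 the sum of a feedforward that uses $\zeta_i$ only on $[t+D_i,\,t+D_i+1/\lambda_i^1]$ and a feedback that uses the predictor functions only at times in $[t-h_i,t]$, with the following properties. Let $t_0\ge\max(1/\lambda_i^1,h_i)$ and put $T=t_0+h_i+D_i$. 1. (Closed loop.) Let $\zeta_i\in H^1([0,\infty),\mathbb R^{n_i})$. For every trajectory from time $t_0$ there is a trajectory from time $t_0$ with the same $v_{i+1}(\cdot,0)$ that coincides with it up to time $T$, whose input is the same up to time $t_0+h_i$ and is given for $t>t_0+h_i$ by the law with $P_{u_i}(t,x)=u_i(t+D_i,x)$, and likewise for the other predictors. 2. (Tracking.) Let $\zeta_i\in H^1([0,\infty),\mathbb R^{n_i})$. For every trajectory from time $t_0$ and all predictor functions exact after $t_0$, if $\hat U_i$ is given by the law for all $t>t_0+h_i$, then $\alpha_i(t,1)=\zeta_i(t)$ for all $t>T+1/\lambda_i^1$. 3. (Stabilization.) There are $C,\nu>0$, depending only on the system, the kernels, $i$ and the law, such that, if $\zeta_i\equiv0$ and $v_{i+1}(\cdot,0)\equiv0$, then for every trajectory and predictor functions as in 2, $$\|(\alpha_i,\beta_i)(t,\cdot)\|_{L^2}\le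 Ce^{-\nu(t-T)}\|(\alpha_i,\beta_i)(T,\cdot)\|_{L^2}\quad(t\ge T),$$ and $(\alpha_i,\beta_i)(t,x)=0$ for all $x\in[0,1]$ and $t>T+1/\lambda_i^1+1/\mu_i^1$. -/

import Mathlib

open MeasureTheory Set

noncomputable section

namespace HypChain

/-- Data of a chain of `N` linear hyperbolic subsystems
`∂ₜuᵢ + Λᵢ⁺ ∂ₓuᵢ = Σᵢ⁺⁺ uᵢ + Σᵢ⁺⁻ vᵢ`, `∂ₜvᵢ - Λᵢ⁻ ∂ₓvᵢ = Σᵢ⁻⁺ uᵢ + Σᵢ⁻⁻ vᵢ` on `[0,1]`,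
`uᵢ(t,0) = Qᵢᵢ vᵢ(t,0) + Qᵢ,ᵢ₋₁ uᵢ₋₁(t,1)`, `vᵢ(t,1) = Rᵢᵢ uᵢ(t,1) + Rᵢ,ᵢ₊₁ vᵢ₊₁(t,0)`.
Subsystems are numbered from `0` to `N - 1`; entries with index `≥ N` play no role. -/
structure Chain where
  N : ℕ
  n : ℕ → ℕ
  m : ℕ → ℕ
  n_pos : ∀ i, 0 < n i
  m_pos : ∀ i, 0 < m i
  /-- rightward transport velocities `λᵢʲ` -/
  lam : (i : ℕ) → Fin (n i) → ℝ
  /-- leftward transport velocities `μᵢʲ` -/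
  mu : (i : ℕ) → Fin (m i) → ℝ
  lam_pos : ∀ i < N, ∀ j, 0 < lam i j
  mu_pos : ∀ i < N, ∀ j, 0 < mu i j
  lam_strictMono : ∀ i < N, StrictMono (lam i)
  mu_strictMono : ∀ i < N, StrictMono (mu i)
  /-- in-domain coupling, as a block matrix indexed by (rightward components) ⊕ (leftward ones) -/
  Sig : (i : ℕ) → ℝ → Matrix (Fin (n i) ⊕ Fin (m i)) (Fin (n i) ⊕ Fin (m i)) ℝ
  Sig_cont : ∀ i < N, ∀ a b, ContinuousOn (fun x => Sig i x a b) (Icc 0 1)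
  Sig_diag : ∀ i < N, ∀ x ∈ Icc (0 : ℝ) 1, ∀ a, Sig i x a a = 0
  /-- `Qᵢᵢ` -/
  Q : (i : ℕ) → Matrix (Fin (n i)) (Fin (m i)) ℝ
  /-- `Rᵢᵢ` -/
  R : (i : ℕ) → Matrix (Fin (m i)) (Fin (n i)) ℝ
  /-- `Qᵢ₊₁,ᵢ` -/
  Qdown : (i : ℕ) → Matrix (Fin (n (i + 1))) (Fin (n i)) ℝ
  /-- `Rᵢ,ᵢ₊₁` -/
  Rup : (i : ℕ) → Matrix (Fin (m i)) (Fin (m (i + 1))) ℝ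

namespace Chain

variable (S : Chain)

/-- Index set of the block state `(uᵢ, vᵢ)`, or `(αᵢ, βᵢ)`, of subsystem `i`:
`Sum.inl j` is the `j`-th rightward component, `Sum.inr j` the `j`-th leftward one. -/
abbrev Idx (i : ℕ) : Type := Fin (S.n i) ⊕ Fin (S.m i)

/-- Signed velocities: the diagonal of `Λᵢ = diag(Λᵢ⁺, -Λᵢ⁻)`. -/
def speed (i : ℕ) : S.Idx i → ℝ := Sum.elim (S.lam i) (fun j => -S.mu i j)

/-- `1/λᵢ¹`, the largest rightward transport time of subsystem `i`. -/
def tr (i : ℕ) : ℝ := (S.lam i ⟨0, S.n_pos i⟩)⁻¹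

/-- `1/μᵢ¹`, the largest leftward transport time of subsystem `i`. -/
def tl (i : ℕ) : ℝ := (S.mu i ⟨0, S.m_pos i⟩)⁻¹

/-- The sum of `1/λⱼ¹` over the subsystems `j` upstream of `i`. -/
def delay (i : ℕ) : ℝ := ∑ j ∈ Finset.range i, S.tr j

/-- `1/λᵢ₋₁¹`, and `0` for the first subsystem. -/
def memory : ℕ → ℝ
  | 0 => 0
  | k + 1 => S.tr k

/-- The matrix `Gᵢ(x)`, strictly upper triangular, attached to a kernel `Kᵢ`. -/
def G (i : ℕ) (K : ℝ → ℝ → Matrix (S.Idx i) (S.Idx i) ℝ) (x : ℝ) :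
    Matrix (Fin (S.n i)) (Fin (S.n i)) ℝ :=
  Matrix.of fun k l =>
    if k < l then
      S.Sig i x (Sum.inl k) (Sum.inl l)
        + (S.lam i l - S.lam i k) * K x x (Sum.inl k) (Sum.inl l)
    else 0

/-- The block matrix `diag(Gᵢ(x), 0)`. -/
def Gblock (i : ℕ) (K : ℝ → ℝ → Matrix (S.Idx i) (S.Idx i) ℝ) (x : ℝ) :
    Matrix (S.Idx i) (S.Idx i) ℝ :=
  Matrix.fromBlocks (S.G i K x) 0 0 0

/-- The backstepping kernels of the chain: bounded Borel kernels `Kᵢ` on `0 ≤ x ≤ y ≤ 1`, in blocks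
`Kᵢᵘᵘ, Kᵢᵘᵛ, Kᵢᵛᵘ, Kᵢᵛᵛ`, and `Fᵢ` on `0 ≤ x ≤ 1`, `0 ≤ y ≤ x/λᵢ¹`, that solve the kernel equations.
The first-order equations are integrated along their characteristics, entry by entry; the boundary
conditions leave out the corners, where they are not compatible with each other in general. The
boundary values of `Kᵢᵛᵛ` that may be chosen at will are left free. -/
structure Kernels where
  K : (i : ℕ) → ℝ → ℝ → Matrix (S.Idx i) (S.Idx i) ℝ
  F : (i : ℕ) → ℝ → ℝ → Matrix (Fin (S.n i)) (Fin (S.m (i + 1))) ℝ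
  K_meas : ∀ i < S.N, ∀ a b, Measurable fun p : ℝ × ℝ => K i p.1 p.2 a b
  K_bdd : ∀ i < S.N, ∃ B : ℝ, ∀ x y : ℝ, 0 ≤ x → x ≤ y → y ≤ 1 → ∀ a b, |K i x y a b| ≤ B
  /-- `Λ ∂ₓK + ∂ᵧK Λ = - K Σ(y) + diag(G(x), 0) K` -/
  K_pde : ∀ i < S.N, ∀ a b, ∀ x y s : ℝ, 0 ≤ x → x ≤ y → y ≤ 1 → 0 ≤ s →
    0 ≤ x + S.speed i a * s → x + S.speed i a * s ≤ y + S.speed i b * s →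
    y + S.speed i b * s ≤ 1 →
    K i (x + S.speed i a * s) (y + S.speed i b * s) a b = K i x y a b +
      ∫ r in (0 : ℝ)..s,
        (-(K i (x + S.speed i a * r) (y + S.speed i b * r) * S.Sig i (y + S.speed i b * r))
          + S.Gblock i (K i) (x + S.speed i a * r)
              * K i (x + S.speed i a * r) (y + S.speed i b * r)) a b
  /-- `Λ K(x,x) - K(x,x) Λ = Σ(x) - diag(G(x), 0)` -/
  K_diag : ∀ i < S.N, ∀ x ∈ Ico (0 : ℝ) 1,
    Matrix.diagonal (S.speed i) * K i x x - K i x x * Matrix.diagonal (S.speed i)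
      = S.Sig i x - S.Gblock i (K i) x
  /-- `Kᵘᵘ(x,1) Λ⁺ = Kᵘᵛ(x,1) Λ⁻ Rᵢᵢ` -/
  K_right : ∀ i < S.N, ∀ x ∈ Ico (0 : ℝ) 1,
    (K i x 1).toBlocks₁₁ * Matrix.diagonal (S.lam i)
      = (K i x 1).toBlocks₁₂ * Matrix.diagonal (S.mu i) * S.R i
  F_meas : ∀ i, i + 1 < S.N → ∀ k l, Measurable fun p : ℝ × ℝ => F i p.1 p.2 k l
  F_bdd : ∀ i, i + 1 < S.N → ∃ B : ℝ, ∀ x y : ℝ, x ≤ 1 → 0 ≤ y → y ≤ x * S.tr i →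
    ∀ k l, |F i x y k l| ≤ B
  /-- `Λ⁺ ∂ₓF + ∂ᵧF = G(x) F` -/
  F_pde : ∀ i, i + 1 < S.N → ∀ k l, ∀ x y s : ℝ, 0 ≤ y → y ≤ x * S.tr i → 0 ≤ s →
    x + S.lam i k * s ≤ 1 →
    F i (x + S.lam i k * s) (y + s) k l = F i x y k l +
      ∫ r in (0 : ℝ)..s,
        (S.G i (K i) (x + S.lam i k * r) * F i (x + S.lam i k * r) (y + r)) k l
  /-- `F(x,0) = - Kᵘᵛ(x,1) Λ⁻ Rᵢ,ᵢ₊₁` -/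
  F_bottom : ∀ i, i + 1 < S.N → ∀ x ∈ Ioc (0 : ℝ) 1,
    F i x 0 = -((K i x 1).toBlocks₁₂ * Matrix.diagonal (S.mu i) * S.Rup i)
  /-- `F(x, x/λ¹)` vanishes except in its first row -/
  F_edge : ∀ i, i + 1 < S.N → ∀ x ∈ Ioc (0 : ℝ) 1, ∀ k : Fin (S.n i), 0 < (k : ℕ) →
    ∀ l, F i x (x * S.tr i) k l = 0

end Chain

variable {S : Chain} (κ : S.Kernels)

namespace Chain.Kernels

/-- `Ḡᵢ(x) = Kᵛᵛ(x,1) Λ⁻ Rᵢᵢ - Kᵛᵘ(x,1) Λ⁺` -/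
def Gbar (i : ℕ) (x : ℝ) : Matrix (Fin (S.m i)) (Fin (S.n i)) ℝ :=
  (κ.K i x 1).toBlocks₂₂ * Matrix.diagonal (S.mu i) * S.R i
    - (κ.K i x 1).toBlocks₂₁ * Matrix.diagonal (S.lam i)

/-- `f̄ᵢ(x) = Kᵛᵛ(x,1) Λ⁻ Rᵢ,ᵢ₊₁` -/
def fbar (i : ℕ) (x : ℝ) : Matrix (Fin (S.m i)) (Fin (S.m (i + 1))) ℝ :=
  (κ.K i x 1).toBlocks₂₂ * Matrix.diagonal (S.mu i) * S.Rup i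

/-- `Qᵢ,ᵢ₋₁ Fᵢ₋₁(1,y)`, and `0` for the first subsystem. -/
def QF : (i : ℕ) → ℝ → Matrix (Fin (S.n i)) (Fin (S.m i)) ℝ
  | 0, _ => 0
  | k + 1, y => S.Qdown k * κ.F k 1 y

/-- `αᵢ(t,1) - ∫₀^{1/λᵢ¹} Fᵢ(1,y) vᵢ₊₁(t-y,0) dy`, which is `uᵢ(t,1)`; here `γ = (αᵢ, βᵢ)` and
`w = vᵢ₊₁(·,0)`. -/
def uOut (i : ℕ) (w : ℝ → Fin (S.m (i + 1)) → ℝ) (γ : ℝ → ℝ → S.Idx i → ℝ) (t : ℝ) :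
    Fin (S.n i) → ℝ :=
  fun j => γ t 1 (Sum.inl j)
    - ∫ y in (0 : ℝ)..S.tr i, (κ.F i 1 y).mulVec (w (t - y)) j

/-- `z = (uᵢ, vᵢ)` and `γ = (αᵢ, βᵢ)` are a trajectory, from time `t₀` on, of subsystem `i` in
backstepping coordinates, with virtual input `U` (entering with the delay `∑_{j<i} 1/λⱼ¹`) and
downstream signal `w = vᵢ₊₁(·,0)`. The transport equations hold in the broad sense: they are
integrated along every characteristic. States are Borel and locally bounded; jumps are allowed. -/
structure IsTrajectory (i : ℕ) (t₀ : ℝ) (U : ℝ → Fin (S.n i) → ℝ)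
    (w : ℝ → Fin (S.m (i + 1)) → ℝ) (z γ : ℝ → ℝ → S.Idx i → ℝ) : Prop where
  z_meas : ∀ a, Measurable fun p : ℝ × ℝ => z p.1 p.2 a
  γ_meas : ∀ a, Measurable fun p : ℝ × ℝ => γ p.1 p.2 a
  w_meas : ∀ l, Measurable fun t => w t l
  z_bdd : ∀ T, ∃ B : ℝ, ∀ t ∈ Icc 0 T, ∀ x ∈ Icc (0 : ℝ) 1, ∀ a, |z t x a| ≤ B
  γ_bdd : ∀ T, ∃ B : ℝ, ∀ t ∈ Icc t₀ T, ∀ x ∈ Icc (0 : ℝ) 1, ∀ a, |γ t x a| ≤ B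
  w_bdd : ∀ T, ∃ B : ℝ, ∀ t ∈ Icc 0 T, ∀ l, |w t l| ≤ B
  /-- `α(t,x) = u(t,x) + ∫₀^{x/λ¹} F(x,y) vᵢ₊₁(t-y,0) dy + ∫ₓ¹ (Kᵘᵘ u + Kᵘᵛ v)(t,y) dy` -/
  transform_α : ∀ t, t₀ ≤ t → ∀ x ∈ Icc (0 : ℝ) 1, ∀ j,
    γ t x (Sum.inl j) = z t x (Sum.inl j)
      + (∫ y in (0 : ℝ)..(x * S.tr i), (κ.F i x y).mulVec (w (t - y)) j)
      + ∫ y in x..1, (κ.K i x y).mulVec (z t y) (Sum.inl j)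
  /-- `β(t,x) = v(t,x) + ∫ₓ¹ (Kᵛᵘ u + Kᵛᵛ v)(t,y) dy` -/
  transform_β : ∀ t, t₀ ≤ t → ∀ x ∈ Icc (0 : ℝ) 1, ∀ j,
    γ t x (Sum.inr j) = z t x (Sum.inr j)
      + ∫ y in x..1, (κ.K i x y).mulVec (z t y) (Sum.inr j)
  /-- `∂ₜα + Λ⁺ ∂ₓα = G(x) α` -/
  pde_α : ∀ j, ∀ t x s : ℝ, t₀ ≤ t → 0 ≤ x → 0 ≤ s → x + S.lam i j * s ≤ 1 →
    γ (t + s) (x + S.lam i j * s) (Sum.inl j) = γ t x (Sum.inl j) +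
      ∫ r in (0 : ℝ)..s, (S.G i (κ.K i) (x + S.lam i j * r)).mulVec
        (fun k => γ (t + r) (x + S.lam i j * r) (Sum.inl k)) j
  /-- `∂ₜβ - Λ⁻ ∂ₓβ = Ḡ(x) u(t,1) + f̄(x) vᵢ₊₁(t,0)`, where `u(t,1)` stands for
  `α(t,1) - ∫₀^{1/λ¹} F(1,y) vᵢ₊₁(t-y,0) dy` -/
  pde_β : ∀ j, ∀ t x s : ℝ, t₀ ≤ t → x ≤ 1 → 0 ≤ s → 0 ≤ x - S.mu i j * s →
    γ (t + s) (x - S.mu i j * s) (Sum.inr j) = γ t x (Sum.inr j) +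
      ∫ r in (0 : ℝ)..s, ((κ.Gbar i (x - S.mu i j * r)).mulVec (κ.uOut i w γ (t + r)) j
        + (κ.fbar i (x - S.mu i j * r)).mulVec (w (t + r)) j)
  /-- `α(t,0) = Qᵢᵢ v(t,0) + U(t - ∑_{j<i} 1/λⱼ¹) + ∫₀¹ (Kᵘᵘ(0,y) u + Kᵘᵛ(0,y) v)(t,y) dy
  - Qᵢ,ᵢ₋₁ ∫₀^{1/λᵢ₋₁¹} Fᵢ₋₁(1,y) v(t-y,0) dy` -/
  bc_α : ∀ t, t₀ < t → ∀ j,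
    γ t 0 (Sum.inl j) = (S.Q i).mulVec (fun k => z t 0 (Sum.inr k)) j + U (t - S.delay i) j
      + (∫ y in (0 : ℝ)..1, (κ.K i 0 y).mulVec (z t y) (Sum.inl j))
      - ∫ y in (0 : ℝ)..S.memory i, (κ.QF i y).mulVec (fun k => z (t - y) 0 (Sum.inr k)) j
  /-- `β(t,1) = Rᵢᵢ α(t,1) + Rᵢ,ᵢ₊₁ vᵢ₊₁(t,0) - Rᵢᵢ ∫₀^{1/λ¹} F(1,y) vᵢ₊₁(t-y,0) dy` -/
  bc_β : ∀ t, t₀ < t → ∀ j,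
    γ t 1 (Sum.inr j) = (S.R i).mulVec (κ.uOut i w γ t) j + (S.Rup i).mulVec (w t) j

end Chain.Kernels

/-- `f ∈ H¹([0,∞), ℝᵈ)`, given by its continuous representative. -/
structure IsH1 {d : ℕ} (f : ℝ → Fin d → ℝ) : Prop where
  cont : ContinuousOn f (Ici 0)
  memLp : ∀ j, MemLp (fun t => f t j) 2 (volume.restrict (Ioi (0 : ℝ)))
  weak_deriv : ∀ j, ∃ g : ℝ → ℝ, MemLp g 2 (volume.restrict (Ioi (0 : ℝ))) ∧
    ∀ φ : ℝ → ℝ, ContDiff ℝ (⊤ : ℕ∞) φ → HasCompactSupport φ → tsupport φ ⊆ Ioi 0 →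
      ∫ t in Ioi (0 : ℝ), f t j * deriv φ t = -∫ t in Ioi (0 : ℝ), g t * φ t

/-- A control law for the virtual input of subsystem `i`: the sum of a feedforward of the reference
and of a causal feedback of the predictor functions `Pz = (P_u, P_v)` and `Pγ = (P_α, P_β)`. -/
structure ControlLaw (S : Chain) (i : ℕ) where
  ff : (ζ : ℝ → Fin (S.n i) → ℝ) → ℝ → Fin (S.n i) → ℝ
  fb : (Pz Pγ : ℝ → ℝ → S.Idx i → ℝ) → ℝ → Fin (S.n i) → ℝ
  /-- at time `t` the reference is used only on `[t + ∑_{j<i} 1/λⱼ¹, t + ∑_{j≤i} 1/λⱼ¹]` -/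
  ff_local : ∀ ζ ζ' t, (∀ s ∈ Icc (t + S.delay i) (t + S.delay i + S.tr i), ζ s = ζ' s) →
    ff ζ t = ff ζ' t
  /-- at time `t` the predictor functions are used only on `[t - 1/λᵢ₋₁¹, t]`
  (only at `t` for the first subsystem) -/
  fb_causal : ∀ Pz Pγ Pz' Pγ' t,
    (∀ s ∈ Icc (t - S.memory i) t, ∀ x ∈ Icc (0 : ℝ) 1, Pz s x = Pz' s x ∧ Pγ s x = Pγ' s x) →
    fb Pz Pγ t = fb Pz' Pγ' t

/-- `P` is an exact `δ`-ahead prediction of `y` at all times `t > t₀`. -/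
def IsPrediction {ι : Type} (δ t₀ : ℝ) (P y : ℝ → ℝ → ι → ℝ) : Prop :=
  ∀ t, t₀ < t → ∀ x ∈ Icc (0 : ℝ) 1, P t x = y (t + δ) x

/-- The input `U` is generated by the law `L` at all times `t > t₁`. -/
def ControlLaw.Drives {i : ℕ} (L : ControlLaw S i) (t₁ : ℝ) (ζ : ℝ → Fin (S.n i) → ℝ)
    (Pz Pγ : ℝ → ℝ → S.Idx i → ℝ) (U : ℝ → Fin (S.n i) → ℝ) : Prop :=
  ∀ t, t₁ < t → U t = L.ff ζ t + L.fb Pz Pγ t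

/-- The norm of `γ(t,·)` in `L²([0,1])`. -/
def normL2 {ι : Type} [Fintype ι] (γ : ℝ → ℝ → ι → ℝ) (t : ℝ) : ℝ :=
  Real.sqrt (∑ a, ∫ x in (0 : ℝ)..1, γ t x a ^ 2)

end HypChain

end

noncomputable section

namespace HypChain

/-! The input enters `bc_α` additively, so exact predictions let the law cancel all other terms at
`x = 0` and prescribe the inlet value of `α` at will. The value to prescribe comes from exchanging
the roles of inlet and outlet. As `G` is strictly upper triangular, `∂ₜα + Λ⁺ ∂ₓα = G α` can be
integrated along characteristics from data on any line `x = x₀`: the last component is purely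
transported, and each other one is driven by those of larger index (`triSolve`). With the reference
as data at `x = 1`, the value at `(t, 0)` uses it only on `[t, t + 1/λᵢ¹]` (`triSolve_one_congr`).
Two solutions with the same inlet values agree once all backward characteristics reach the inlet
(`triangular_unique`); hence `α` becomes the transported reference (`IsTrajectory.eq_triSolve`),
whose value at `x = 1` is `ζ`.

The closed loop looks circular, because the law needs future states. The circle is broken by
prescribing the inlet values of `α` first and reading the input off `bc_α` afterwards. By linearity
it suffices to propagate the change of the inlet (`IsTrajectory.exists_perturbation`): through the
triangular system to the outlet, from there through `R` and `Ḡ` into `β`, and back to `(u, v)` by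
solving a Volterra equation (`exists_volterra_solution`). The terms with `F` depend only on the
downstream signal and do not change.

For zero reference and downstream signal, `α` dies out after `1/λᵢ¹` and `β` after a further `1/μᵢ¹`
(`IsTrajectory.eq_zero`). Exponential decay then reduces to an `L²` growth bound over this bounded
window (`exists_trajectory_sqInt_bound`). The delicate quantity is the outlet trace of `α`, which
feeds `β`: the `L²` norm in space at a fixed time does not control it, but its square integral in
time is controlled by the initial norm (`exists_outlet_bound`). -/

/-- A finite family of upward closed conditions on a bound can be met by one nonnegative bound. -/
lemma exists_uniform_bound {ι : Type*} [Finite ι] {P : ι → ℝ → Prop}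
    (mono : ∀ i B B', B ≤ B' → P i B → P i B') (h : ∀ i, ∃ B, P i B) :
    ∃ B, 0 ≤ B ∧ ∀ i, P i B := by
  choose B hB using h
  obtain ⟨M, hM⟩ := Set.finite_range B |>.bddAbove
  exact ⟨max M 0, le_max_right _ _, fun i =>
    mono i _ _ ((hM (mem_range_self i)).trans (le_max_left _ _)) (hB i)⟩

/-! ### Integrability and measurability of bounded Borel functions. -/

lemma intervalIntegrable_of_bdd {f : ℝ → ℝ} (hf : Measurable f) {a b B : ℝ}
    (h : ∀ r ∈ uIcc a b, |f r| ≤ B) : IntervalIntegrable f volume a b := by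
  rw [intervalIntegrable_iff]
  refine Measure.integrableOn_of_bounded (M := B) (by simp) hf.aestronglyMeasurable ?_
  filter_upwards [self_mem_ae_restrict measurableSet_uIoc] with r hr
  exact h r (uIoc_subset_uIcc hr)

/-- An oriented integral is a difference of two integrals over `Ioc`, and each of these is the
integral over the whole line of a jointly measurable indicator. -/
lemma measurable_intervalIntegral {α : Type*} [MeasurableSpace α] {f : α × ℝ → ℝ}
    (hf : Measurable f) {c d : α → ℝ} (hc : Measurable c) (hd : Measurable d) :
    Measurable fun p => ∫ r in c p..d p, f (p, r) := by
  have key : ∀ {c d : α → ℝ}, Measurable c → Measurable d →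
      Measurable fun p => ∫ r in Ioc (c p) (d p), f (p, r) := by
    intro c d hc hd
    have hs : MeasurableSet {q : α × ℝ | q.2 ∈ Ioc (c q.1) (d q.1)} :=
      (measurableSet_lt (hc.comp measurable_fst) measurable_snd).inter
        (measurableSet_le measurable_snd (hd.comp measurable_fst))
    have := ((hf.indicator hs).stronglyMeasurable.integral_prod_right' (ν := volume)).measurable
    convert this using 2 with p
    rw [← integral_indicator measurableSet_Ioc]
    rfl
  exact (key hc hd).sub (key hd hc)

/-- Bounded on bounded sets of `ℝ × ℝ`. -/
def LocBdd (f : ℝ → ℝ → ℝ) : Prop :=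
  ∀ R : ℝ, ∃ B : ℝ, ∀ t x : ℝ, |t| ≤ R → |x| ≤ R → |f t x| ≤ B

/-! ### Triangular transport systems solved along characteristics. -/

section Triangular

variable {n : ℕ} (lam : Fin n → ℝ) (G : ℝ → Matrix (Fin n) (Fin n) ℝ) (x₀ : ℝ)

/-- Solution of `∂ₜ a + Λ ∂ₓ a = G(x) a`, `G` strictly upper triangular, with data `d` at `x = x₀`,
integrated along the characteristics that pass through `x = x₀`. -/
def triSolve (d : ℝ → Fin n → ℝ) (k : Fin n) (t x : ℝ) : ℝ :=
  -- The travel time `(x - x₀) / lam k` is signed, so one formula serves both sides of `x₀`. The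
  -- guard `k < l` provides the decrease that the recursion needs.
  d (t - (x - x₀) / lam k) k + ∫ r in (0 : ℝ)..(x - x₀) / lam k,
    ∑ l : Fin n, if _h : k < l then
      G (x₀ + lam k * r) k l * triSolve d l (t - (x - x₀) / lam k + r) (x₀ + lam k * r) else 0
termination_by n - k

variable {lam G x₀}

lemma triSolve_eq (hG : ∀ x k l, ¬ k < l → G x k l = 0) (d : ℝ → Fin n → ℝ) (k : Fin n)
    (t x : ℝ) :
    triSolve lam G x₀ d k t x = d (t - (x - x₀) / lam k) k + ∫ r in (0 : ℝ)..(x - x₀) / lam k,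
      (G (x₀ + lam k * r)).mulVec (fun l => triSolve lam G x₀ d l (t - (x - x₀) / lam k + r)
        (x₀ + lam k * r)) k := by
  rw [triSolve]
  congr 1
  refine intervalIntegral.integral_congr fun r _ => ?_
  simp only [Matrix.mulVec, dotProduct]
  refine Finset.sum_congr rfl fun l _ => ?_
  split_ifs with h
  · rfl
  · rw [hG _ _ _ h, zero_mul]

lemma triSolve_anchor (d : ℝ → Fin n → ℝ) (k : Fin n) (t : ℝ) :
    triSolve lam G x₀ d k t x₀ = d t k := by
  rw [triSolve]; simp

lemma measurable_triSolve (hG : ∀ k l, Measurable fun x => G x k l) {d : ℝ → Fin n → ℝ}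
    (hd : ∀ k, Measurable fun t => d t k) (k : Fin n) :
    Measurable fun p : ℝ × ℝ => triSolve lam G x₀ d k p.1 p.2 := by
  induction k using WellFoundedGT.induction with
  | _ k ih =>
    have e : (fun p : ℝ × ℝ => triSolve lam G x₀ d k p.1 p.2) = fun p : ℝ × ℝ =>
        d (p.1 - (p.2 - x₀) / lam k) k + ∫ r in (0 : ℝ)..(p.2 - x₀) / lam k,
        ∑ l : Fin n, if _h : k < l then G (x₀ + lam k * r) k l *
          triSolve lam G x₀ d l (p.1 - (p.2 - x₀) / lam k + r) (x₀ + lam k * r) else 0 := by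
      funext p; rw [triSolve]
    rw [e]
    refine ((hd k).comp (by fun_prop)).add
      (measurable_intervalIntegral (f := fun q : (ℝ × ℝ) × ℝ => ∑ l : Fin n, if _h : k < l then
        G (x₀ + lam k * q.2) k l *
          triSolve lam G x₀ d l (q.1.1 - (q.1.2 - x₀) / lam k + q.2) (x₀ + lam k * q.2) else 0)
        ?_ (by fun_prop) (by fun_prop))
    refine Finset.measurable_fun_sum _ fun l _ => ?_
    by_cases h : k < l
    · simp only [h, dite_true]
      exact ((hG k l).comp (by fun_prop : Measurable fun q : (ℝ × ℝ) × ℝ => x₀ + lam k * q.2)).mul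
        ((ih l h).comp (by fun_prop : Measurable fun q : (ℝ × ℝ) × ℝ =>
          (q.1.1 - (q.1.2 - x₀) / lam k + q.2, x₀ + lam k * q.2)))
    · simp [h]

lemma locBdd_triSolve {BG : ℝ} (hG : ∀ x k l, |G x k l| ≤ BG) {d : ℝ → Fin n → ℝ}
    (hd : ∀ R : ℝ, ∃ B : ℝ, ∀ t k, |t| ≤ R → |d t k| ≤ B) (k : Fin n) :
    LocBdd (triSolve lam G x₀ d k) := by
  induction k using WellFoundedGT.induction with
  | _ k ih =>
    intro R
    -- `a` bounds the travel time to the line `x = x₀`, and the box of size `R'` contains every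
    -- characteristic segment used from the box of size `R`.
    set a := (R + |x₀|) / |lam k| with ha
    set R' := max (R + a + a) (|x₀| + |lam k| * a) with hR'
    obtain ⟨Bd, hBd⟩ := hd (R + a)
    obtain ⟨B, hB0, hB⟩ := exists_uniform_bound (ι := Fin n)
      (P := fun l B => k < l → ∀ t x : ℝ, |t| ≤ R' → |x| ≤ R' → |triSolve lam G x₀ d l t x| ≤ B)
      (fun l B B' h hP hk t x ht hx => (hP hk t x ht hx).trans h)
      (fun l => by
        by_cases h : k < l
        · obtain ⟨B, hB⟩ := ih l h R'
          exact ⟨B, fun _ => hB⟩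
        · exact ⟨0, fun h' => absurd h' h⟩)
    have hBG : 0 ≤ BG := (abs_nonneg _).trans (hG 0 k k)
    refine ⟨Bd + (n * (BG * B)) * a, fun t x ht hx => ?_⟩
    have h1 : |(x - x₀) / lam k| ≤ a := by
      rw [abs_div]
      exact div_le_div_of_nonneg_right ((abs_sub _ _).trans (by linarith)) (abs_nonneg _)
    rw [triSolve]
    refine (abs_add_le _ _).trans (add_le_add (hBd _ _ ?_) ?_)
    · exact (abs_sub _ _).trans (by linarith)
    rw [← Real.norm_eq_abs]
    refine (intervalIntegral.norm_integral_le_of_norm_le_const (C := n * (BG * B))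
      fun r hr => ?_).trans ?_
    · have hr' : |r| ≤ a := by
        have := abs_sub_left_of_mem_uIcc (uIoc_subset_uIcc hr)
        simpa using this.trans (by simpa using h1)
      refine (norm_sum_le_of_le (f := fun l => if _h : k < l then G (x₀ + lam k * r) k l *
          triSolve lam G x₀ d l (t - (x - x₀) / lam k + r) (x₀ + lam k * r) else 0)
          (n := fun _ => BG * B) _ fun l _ => ?_).trans (by simp)
      by_cases h : k < l
      · simp only [h, dite_true, Real.norm_eq_abs, abs_mul]
        refine mul_le_mul (hG _ _ _) (hB l h _ _ ?_ ?_) (abs_nonneg _) hBG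
        · refine le_trans ?_ (le_max_left _ _)
          refine (abs_add_le _ _).trans (add_le_add ((abs_sub _ _).trans ?_) hr')
          linarith
        · refine le_trans ((abs_add_le _ _).trans ?_) (le_max_right _ _)
          rw [abs_mul]
          have := mul_le_mul_of_nonneg_left hr' (abs_nonneg (lam k))
          linarith
      · simp only [h, dite_false, norm_zero]
        positivity
    · rw [sub_zero]
      exact mul_le_mul_of_nonneg_left h1 (by positivity)

lemma mulVec_intervalIntegrable {G : ℝ → Matrix (Fin n) (Fin n) ℝ} {BG : ℝ}
    (hGm : ∀ k l, Measurable fun x => G x k l) (hG : ∀ x k l, |G x k l| ≤ BG)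
    {a : ℝ → Fin n → ℝ} (ham : ∀ l, Measurable fun r => a r l) {p q B : ℝ}
    (ha : ∀ r ∈ uIcc p q, ∀ l, |a r l| ≤ B) (x c : ℝ) (k : Fin n) :
    IntervalIntegrable (fun r => (G (x + c * r)).mulVec (a r) k) volume p q := by
  refine intervalIntegrable_of_bdd (B := n * (BG * B)) ?_ fun r hr => ?_
  · simp only [Matrix.mulVec, dotProduct]
    exact Finset.measurable_fun_sum _ fun l _ => ((hGm k l).comp (by fun_prop)).mul (ham l)
  · rw [← Real.norm_eq_abs]
    refine (norm_sum_le_of_le (f := fun l => G (x + c * r) k l * a r l)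
      (n := fun _ => BG * B) Finset.univ fun l _ => ?_).trans (by simp)
    rw [norm_mul]
    exact mul_le_mul (hG _ _ _) (ha r hr l) (abs_nonneg _) ((abs_nonneg _).trans (hG 0 k k))

lemma triSolve_intervalIntegrable {BG : ℝ} (hGm : ∀ k l, Measurable fun x => G x k l)
    (hGb : ∀ x k l, |G x k l| ≤ BG) {d : ℝ → Fin n → ℝ} (hdm : ∀ k, Measurable fun t => d t k)
    (hd : ∀ R : ℝ, ∃ B : ℝ, ∀ t k, |t| ≤ R → |d t k| ≤ B) (k : Fin n) (t x p q c : ℝ) :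
    IntervalIntegrable (fun r => (G (x + c * r)).mulVec
      (fun l => triSolve lam G x₀ d l (t + r) (x + c * r)) k) volume p q := by
  set R := max (|t| + max |p| |q|) (|x| + |c| * max |p| |q|)
  obtain ⟨B, -, hB⟩ := exists_uniform_bound (ι := Fin n)
    (P := fun l B => ∀ t x : ℝ, |t| ≤ R → |x| ≤ R → |triSolve lam G x₀ d l t x| ≤ B)
    (fun l B B' h hP t x ht hx => (hP t x ht hx).trans h) (fun l => locBdd_triSolve hGb hd l R)
  refine mulVec_intervalIntegrable hGm hGb (B := B) (fun l => ?_) (fun r hr l => ?_) x c k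
  · exact (measurable_triSolve hGm hdm l).comp
      (by fun_prop : Measurable fun r : ℝ => (t + r, x + c * r))
  · have hr' : |r| ≤ max |p| |q| := by
      rcases mem_uIcc.1 hr with h | h
      · exact abs_le_max_abs_abs h.1 h.2
      · rw [max_comm]; exact abs_le_max_abs_abs h.1 h.2
    refine hB l _ _ ?_ ?_
    · exact le_trans ((abs_add_le _ _).trans (by linarith)) (le_max_left _ _)
    · refine le_trans ((abs_add_le _ _).trans ?_) (le_max_right _ _)
      rw [abs_mul]
      have := mul_le_mul_of_nonneg_left hr' (abs_nonneg c)
      linarith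

lemma triSolve_pde {BG : ℝ} (hGm : ∀ k l, Measurable fun x => G x k l)
    (hGb : ∀ x k l, |G x k l| ≤ BG) (hG : ∀ x k l, ¬ k < l → G x k l = 0)
    {d : ℝ → Fin n → ℝ} (hdm : ∀ k, Measurable fun t => d t k)
    (hd : ∀ R : ℝ, ∃ B : ℝ, ∀ t k, |t| ≤ R → |d t k| ≤ B) {k : Fin n} (hk : lam k ≠ 0)
    (t x s : ℝ) :
    triSolve lam G x₀ d k (t + s) (x + lam k * s) = triSolve lam G x₀ d k t x +
      ∫ r in (0 : ℝ)..s, (G (x + lam k * r)).mulVec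
        (fun l => triSolve lam G x₀ d l (t + r) (x + lam k * r)) k := by
  rw [triSolve_eq hG, triSolve_eq hG d k t x]
  -- With `r` measured from the crossing of `x = x₀`, both solution formulas integrate over the same
  -- characteristic, on `[0, p]` and `[0, p + s]`; the equation is additivity of the integral.
  set p := (x - x₀) / lam k with hp
  have e1 : (x + lam k * s - x₀) / lam k = p + s := by rw [hp]; field_simp; ring
  have e2 : t + s - (p + s) = t - p := by ring
  have hx : x = x₀ + lam k * p := by rw [hp]; field_simp; ring
  have e3 : ∫ r in (0 : ℝ)..s, (G (x + lam k * r)).mulVec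
        (fun l => triSolve lam G x₀ d l (t + r) (x + lam k * r)) k
      = ∫ r in p..p + s, (G (x₀ + lam k * r)).mulVec
        (fun l => triSolve lam G x₀ d l (t - p + r) (x₀ + lam k * r)) k := by
    have := intervalIntegral.integral_comp_add_left (a := 0) (b := s)
      (fun r => (G (x₀ + lam k * r)).mulVec
        (fun l => triSolve lam G x₀ d l (t - p + r) (x₀ + lam k * r)) k) p
    rw [add_zero] at this
    rw [← this]
    refine intervalIntegral.integral_congr fun r _ => ?_
    rw [show x₀ + lam k * (p + r) = x + lam k * r by rw [hx]; ring,
      show t - p + (p + r) = t + r by ring]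
  rw [e1, e2, e3, add_assoc, intervalIntegral.integral_add_adjacent_intervals]
  · exact triSolve_intervalIntegrable hGm hGb hdm hd k (t - p) x₀ 0 p (lam k)
  · exact triSolve_intervalIntegrable hGm hGb hdm hd k (t - p) x₀ p (p + s) (lam k)

lemma triSolve_zero (hd : ∀ t, d t = 0) (k : Fin n) (t x : ℝ) :
    triSolve lam G x₀ d k t x = 0 := by
  induction k using WellFoundedGT.induction generalizing t x with
  | _ k ih =>
    rw [triSolve, hd, Pi.zero_apply, zero_add]
    refine (intervalIntegral.integral_congr fun r _ => ?_).trans intervalIntegral.integral_zero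
    refine Finset.sum_eq_zero fun l _ => ?_
    split_ifs with h
    · rw [ih l h, mul_zero]
    · rfl

/-- With data at `x = 1`, the solution at `(t, x)` uses the data only on `[t, t + (1 - x) τ]`, where
`τ` is the largest transport time. -/
lemma triSolve_one_congr (hlam : ∀ k, 0 < lam k) {τ : ℝ} (hτ : ∀ k, (lam k)⁻¹ ≤ τ) {t₀ t₁ : ℝ}
    {d d' : ℝ → Fin n → ℝ} (hd : ∀ s ∈ Icc t₀ t₁, d s = d' s) (k : Fin n) {t x : ℝ}
    (hx : x ≤ 1) (ht : t₀ ≤ t) (ht' : t + (1 - x) * τ ≤ t₁) :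
    triSolve lam G 1 d k t x = triSolve lam G 1 d' k t x := by
  induction k using WellFoundedGT.induction generalizing t x with
  | _ k ih =>
    have hk := hlam k
    set p := (1 - x) / lam k with hp
    have hp0 : 0 ≤ p := div_nonneg (by linarith) hk.le
    have e : (x - 1) / lam k = -p := by rw [hp]; ring
    have hpx : 1 - x = lam k * p := by rw [hp]; field_simp
    have hpτ : p ≤ (1 - x) * τ := by
      rw [hp, div_eq_mul_inv]
      exact mul_le_mul_of_nonneg_left (hτ k) (by linarith)
    rw [triSolve, triSolve, e, sub_neg_eq_add, hd _ ⟨by linarith, by linarith⟩]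
    congr 1
    refine intervalIntegral.integral_congr fun r hr => ?_
    rw [uIcc_of_ge (by linarith)] at hr
    refine Finset.sum_congr rfl fun l _ => ?_
    split_ifs with h
    · congr 1
      refine ih l h ?_ ?_ ?_
      · nlinarith [hr.2]
      · linarith [hr.1]
      -- Along the `k`-th characteristic, `t + (1 - x) τ` has slope `1 - lam k * τ ≤ 0`, so it never
      -- exceeds its value at the starting point on the way to `x = 1`.
      · have h1 : 1 ≤ lam k * τ := by
          have := mul_le_mul_of_nonneg_left (hτ k) hk.le
          rwa [mul_inv_cancel₀ hk.ne'] at this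
        have h2 : (p + r) * (1 - lam k * τ) ≤ 0 :=
          mul_nonpos_of_nonneg_of_nonpos (by linarith [hr.1]) (by linarith)
        rw [hpx] at ht'
        nlinarith
    · rfl

/-- With data at `x = 0` that vanish up to time `T`, the solution vanishes up to time `T`. -/
lemma triSolve_eq_zero_of_le (hlam : ∀ k, 0 < lam k) {T : ℝ} {d : ℝ → Fin n → ℝ}
    (hd : ∀ t ≤ T, d t = 0) (k : Fin n) {t x : ℝ} (hx : 0 ≤ x) (ht : t ≤ T) :
    triSolve lam G 0 d k t x = 0 := by
  induction k using WellFoundedGT.induction generalizing t x with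
  | _ k ih =>
    have hk := hlam k
    have hp : 0 ≤ x / lam k := div_nonneg hx hk.le
    rw [triSolve, sub_zero, hd _ (by linarith), Pi.zero_apply, zero_add]
    refine (intervalIntegral.integral_congr fun r hr => ?_).trans intervalIntegral.integral_zero
    rw [uIcc_of_le hp] at hr
    refine Finset.sum_eq_zero fun l _ => ?_
    split_ifs with h
    · rw [ih l h (by nlinarith [hr.1]) (by linarith [hr.2]), mul_zero]
    · rfl

/-- Two solutions with the same values at `x = 0` after time `T` agree where every backward
characteristic reaches `x = 0` after time `T`. -/
lemma triangular_unique (hlam : ∀ k, 0 < lam k) (hG : ∀ x k l, ¬ k < l → G x k l = 0)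
    {τ : ℝ} (hτ : ∀ k, (lam k)⁻¹ ≤ τ) {T : ℝ} {a a' : Fin n → ℝ → ℝ → ℝ}
    (h0 : ∀ k t, T < t → a k t 0 = a' k t 0)
    (ha : ∀ k t s, T < t → 0 ≤ s → lam k * s ≤ 1 → a k (t + s) (lam k * s) = a k t 0 +
      ∫ r in (0 : ℝ)..s, (G (lam k * r)).mulVec (fun l => a l (t + r) (lam k * r)) k)
    (ha' : ∀ k t s, T < t → 0 ≤ s → lam k * s ≤ 1 → a' k (t + s) (lam k * s) = a' k t 0 +
      ∫ r in (0 : ℝ)..s, (G (lam k * r)).mulVec (fun l => a' l (t + r) (lam k * r)) k)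
    (k : Fin n) {t x : ℝ} (hx : 0 ≤ x) (hx1 : x ≤ 1) (ht : T < t - x * τ) :
    a k t x = a' k t x := by
  induction k using WellFoundedGT.induction generalizing t x with
  | _ k ih =>
    have hk := hlam k
    set p := x / lam k with hp
    have hp0 : 0 ≤ p := div_nonneg hx hk.le
    have hpx : lam k * p = x := by rw [hp]; field_simp
    have hpτ : p ≤ x * τ := by
      rw [hp, div_eq_mul_inv]
      exact mul_le_mul_of_nonneg_left (hτ k) hx
    have h1 := ha k (t - p) p (by linarith) hp0 (by linarith)
    have h2 := ha' k (t - p) p (by linarith) hp0 (by linarith)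
    rw [hpx, sub_add_cancel] at h1 h2
    rw [h1, h2, h0 k _ (by linarith)]
    congr 1
    refine intervalIntegral.integral_congr fun r hr => ?_
    rw [uIcc_of_le hp0] at hr
    simp only [Matrix.mulVec, dotProduct]
    refine Finset.sum_congr rfl fun l _ => ?_
    by_cases h : k < l
    · congr 1
      refine ih l h (mul_nonneg hk.le hr.1) ?_ ?_
      · nlinarith [hr.2]
      -- The quantity `t - x τ` has slope `1 - lam k * τ ≤ 0` along the characteristic. It therefore
      -- only grows backward in time, and the region `T < t - x τ` is not left.
      · have h1 : 1 ≤ lam k * τ := by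
          have := mul_le_mul_of_nonneg_left (hτ k) hk.le
          rwa [mul_inv_cancel₀ hk.ne'] at this
        have h2 : (p - r) * (1 - lam k * τ) ≤ 0 :=
          mul_nonpos_of_nonneg_of_nonpos (by linarith [hr.2]) (by linarith)
        rw [← hpx] at ht
        nlinarith
    · rw [hG _ _ _ h, zero_mul, zero_mul]

end Triangular

/-! ### Volterra equations of the second kind by Neumann series. -/

section Volterra

variable {ι : Type*} [Fintype ι] (K : ℝ → ℝ → Matrix ι ι ℝ) (g : ℝ → ℝ → ι → ℝ)

/-- The terms of the Neumann series of `g(t,x) = e(t,x) + ∫ₓ¹ K(x,y) e(t,y) dy`. -/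
def volterraTerm : ℕ → ℝ → ℝ → ι → ℝ
  | 0, t, x, a => if x ∈ Icc (0 : ℝ) 1 then g t x a else 0
  | m + 1, t, x, a =>
    if x ∈ Icc (0 : ℝ) 1 then -∫ y in x..1, (K x y).mulVec (volterraTerm m t y) a else 0

variable {K g}

lemma measurable_volterraTerm (hK : ∀ a b, Measurable fun p : ℝ × ℝ => K p.1 p.2 a b)
    (hg : ∀ a, Measurable fun p : ℝ × ℝ => g p.1 p.2 a) (m : ℕ) (a : ι) :
    Measurable fun p : ℝ × ℝ => volterraTerm K g m p.1 p.2 a := by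
  have hs : MeasurableSet {p : ℝ × ℝ | p.2 ∈ Icc (0 : ℝ) 1} := measurable_snd measurableSet_Icc
  induction m generalizing a with
  | zero => exact Measurable.ite hs (hg a) measurable_const
  | succ m ih =>
    refine Measurable.ite hs (Measurable.neg ?_) measurable_const
    refine measurable_intervalIntegral (f := fun q : (ℝ × ℝ) × ℝ =>
      (K q.1.2 q.2).mulVec (volterraTerm K g m q.1.1 q.2) a) ?_ measurable_snd measurable_const
    simp only [Matrix.mulVec, dotProduct]
    refine Finset.measurable_fun_sum _ fun b _ => ?_
    exact ((hK a b).comp (by fun_prop : Measurable fun q : (ℝ × ℝ) × ℝ => (q.1.2, q.2))).mul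
      ((ih b).comp (by fun_prop : Measurable fun q : (ℝ × ℝ) × ℝ => (q.1.1, q.2)))

lemma integral_exp_weight {θ : ℝ} (hθ : θ ≠ 0) (x : ℝ) :
    ∫ y in x..1, Real.exp (θ * (1 - y)) = (Real.exp (θ * (1 - x)) - 1) / θ := by
  have h : ∀ y ∈ uIcc x 1, HasDerivAt (fun y => -(Real.exp (θ * (1 - y)) / θ))
      (Real.exp (θ * (1 - y))) y := by
    intro y _
    have := ((((hasDerivAt_id y).const_sub 1).const_mul θ).exp.div_const θ).neg
    refine this.congr_deriv ?_
    field_simp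
    simp
  rw [intervalIntegral.integral_eq_sub_of_hasDerivAt h
    (Continuous.intervalIntegrable (by fun_prop) _ _)]
  simp; ring

/-- In the weight `exp (θ (1 - x))` the integral operator has norm at most `card ι * B / θ`, which
the choice of `θ` makes equal to `1/2`. The terms vanish outside `[0,1]`, so the bound holds for
every `x` and the induction needs no side condition. -/
lemma abs_volterraTerm_le {B : ℝ} (hB0 : 0 < B)
    (hB : ∀ x y : ℝ, 0 ≤ x → x ≤ y → y ≤ 1 → ∀ a b, |K x y a b| ≤ B) {t M : ℝ} (hM0 : 0 ≤ M)
    (hM : ∀ x ∈ Icc (0 : ℝ) 1, ∀ a, |g t x a| ≤ M) (m : ℕ) (x : ℝ) (a : ι) :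
    |volterraTerm K g m t x a| ≤
      M * Real.exp (2 * (Fintype.card ι * B) * (1 - x)) * (1 / 2) ^ m := by
  set θ := 2 * (Fintype.card ι * B) with hθ
  have hn : (0 : ℝ) < Fintype.card ι := by
    exact_mod_cast Fintype.card_pos_iff.2 ⟨a⟩
  have hθ0 : 0 < θ := by positivity
  induction m generalizing x a with
  | zero =>
    rw [volterraTerm]
    split_ifs with h
    · refine (hM x h a).trans ?_
      have : 1 ≤ Real.exp (θ * (1 - x)) :=
        Real.one_le_exp (mul_nonneg hθ0.le (by linarith [h.2]))
      rw [pow_zero, mul_one]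
      nlinarith
    · rw [abs_zero]; positivity
  | succ m ih =>
    rw [volterraTerm]
    split_ifs with h
    · rw [abs_neg, ← Real.norm_eq_abs]
      have h1 : ‖∫ y in x..1, (K x y).mulVec (volterraTerm K g m t y) a‖ ≤
          ∫ y in x..1, (Fintype.card ι * (B * (M * (1 / 2) ^ m))) * Real.exp (θ * (1 - y)) := by
        refine intervalIntegral.norm_integral_le_of_norm_le h.2 ?_
          (Continuous.intervalIntegrable (by fun_prop) _ _)
        refine Filter.Eventually.of_forall fun y hy => ?_
        refine (norm_sum_le_of_le (f := fun b => K x y a b * volterraTerm K g m t y b)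
          (n := fun _ => B * (M * Real.exp (θ * (1 - y)) * (1 / 2) ^ m))
          Finset.univ fun b _ => ?_).trans ?_
        · rw [norm_mul]
          exact mul_le_mul (hB x y h.1 hy.1.le hy.2 a b) (ih y b) (abs_nonneg _) hB0.le
        · rw [Finset.sum_const, nsmul_eq_mul, Finset.card_univ]
          exact le_of_eq (by ring)
      refine h1.trans ?_
      rw [intervalIntegral.integral_const_mul, integral_exp_weight hθ0.ne']
      have h2 : Fintype.card ι * (B * (M * (1 / 2) ^ m)) *
          ((Real.exp (θ * (1 - x)) - 1) / θ) =
          M * (Real.exp (θ * (1 - x)) - 1) * (1 / 2) ^ (m + 1) := by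
        rw [hθ, pow_succ]; field_simp
      rw [h2]
      gcongr
      linarith
    · rw [abs_zero]; positivity

/-- Volterra equations of the second kind with a bounded kernel have jointly measurable solutions,
bounded in terms of the data at the same time. -/
lemma exists_volterra_solution (hK : ∀ a b, Measurable fun p : ℝ × ℝ => K p.1 p.2 a b) {B : ℝ}
    (hB : ∀ x y : ℝ, 0 ≤ x → x ≤ y → y ≤ 1 → ∀ a b, |K x y a b| ≤ B)
    (hg : ∀ a, Measurable fun p : ℝ × ℝ => g p.1 p.2 a)
    (hgb : ∀ t, ∃ M, ∀ x ∈ Icc (0 : ℝ) 1, ∀ a, |g t x a| ≤ M) :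
    ∃ (e : ℝ → ℝ → ι → ℝ) (C : ℝ), (∀ a, Measurable fun p : ℝ × ℝ => e p.1 p.2 a) ∧
      (∀ t M, 0 ≤ M → (∀ x ∈ Icc (0 : ℝ) 1, ∀ a, |g t x a| ≤ M) →
        ∀ x ∈ Icc (0 : ℝ) 1, ∀ a, |e t x a| ≤ C * M) ∧
      ∀ t, ∀ x ∈ Icc (0 : ℝ) 1, ∀ a, g t x a = e t x a + ∫ y in x..1, (K x y).mulVec (e t y) a := by
  -- The geometric estimate divides by `θ`, hence the strictly positive bound.
  obtain ⟨B, hB0, hB⟩ : ∃ B, 0 < B ∧ ∀ x y : ℝ, 0 ≤ x → x ≤ y → y ≤ 1 → ∀ a b, |K x y a b| ≤ B :=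
    ⟨max B 1, by positivity, fun x y h h' h'' a b => (hB x y h h' h'' a b).trans (le_max_left _ _)⟩
  set θ := 2 * (Fintype.card ι * B) with hθ
  have hθ0 : 0 ≤ θ := by positivity
  have hVm := measurable_volterraTerm hK hg
  have hbd := fun t M h0 hM => abs_volterraTerm_le (g := g) hB0 hB (t := t) (M := M) h0 hM
  have hsum : ∀ t x a, Summable fun m => volterraTerm K g m t x a := by
    intro t x a
    obtain ⟨M, hM⟩ := hgb t
    have hM' : ∀ x ∈ Icc (0 : ℝ) 1, ∀ a, |g t x a| ≤ max M 0 :=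
      fun x hx a => (hM x hx a).trans (le_max_left _ _)
    refine Summable.of_norm_bounded (g := fun m => max M 0 * Real.exp (θ * (1 - x)) * (1 / 2) ^ m)
      ?_ fun m => hbd t _ (le_max_right _ _) hM' m x a
    exact (summable_geometric_of_lt_one (by norm_num) (by norm_num)).mul_left _
  -- The explicit series gives joint measurability in `(t, x)` as a pointwise limit. Each time slice
  -- depends on the data at that time alone; the factor 2 is the sum of the geometric series.
  refine ⟨fun t x a => ∑' m, volterraTerm K g m t x a, 2 * Real.exp θ, fun a => ?_, ?_, ?_⟩
  · refine measurable_of_tendsto_metrizable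
      (f := fun N (p : ℝ × ℝ) => ∑ m ∈ Finset.range N, volterraTerm K g m p.1 p.2 a)
      (fun N => Finset.measurable_fun_sum _ fun m _ => hVm m a) ?_
    exact tendsto_pi_nhds.2 fun p => (hsum p.1 p.2 a).hasSum.tendsto_sum_nat
  · intro t M hM0 hM x hx a
    have hs : HasSum (fun m : ℕ => M * Real.exp (θ * (1 - x)) * (1 / 2) ^ m)
        (M * Real.exp (θ * (1 - x)) * 2) := by
      have := (hasSum_geometric_of_lt_one (r := (1 / 2 : ℝ)) (by norm_num) (by norm_num)).mul_left
        (M * Real.exp (θ * (1 - x)))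
      rwa [show (1 - 1 / 2 : ℝ)⁻¹ = 2 by norm_num] at this
    rw [← Real.norm_eq_abs]
    refine (tsum_of_norm_bounded hs fun m => hbd t M hM0 hM m x a).trans ?_
    have : Real.exp (θ * (1 - x)) ≤ Real.exp θ := Real.exp_le_exp.2 (by nlinarith [hx.1])
    nlinarith
  · intro t x hx a
    obtain ⟨M, hM⟩ := hgb t
    have hM' : ∀ x ∈ Icc (0 : ℝ) 1, ∀ a, |g t x a| ≤ max M 0 :=
      fun x hx a => (hM x hx a).trans (le_max_left _ _)
    have hint : HasSum (fun m => ∫ y in x..1, (K x y).mulVec (volterraTerm K g m t y) a)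
        (∫ y in x..1, (K x y).mulVec (fun b => ∑' m, volterraTerm K g m t y b) a) := by
      refine intervalIntegral.hasSum_integral_of_dominated_convergence
        (fun m _ => Fintype.card ι * (B * (max M 0 * Real.exp θ)) * (1 / 2) ^ m)
        (fun m => ?_) (fun m => ?_) ?_ intervalIntegrable_const ?_
      · refine (Measurable.aestronglyMeasurable ?_)
        simp only [Matrix.mulVec, dotProduct]
        exact Finset.measurable_fun_sum _ fun b _ =>
          ((hK a b).comp (by fun_prop : Measurable fun y : ℝ => (x, y))).mul
            ((hVm m b).comp (by fun_prop : Measurable fun y : ℝ => (t, y)))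
      · refine Filter.Eventually.of_forall fun y hy => ?_
        rw [uIoc_of_le hx.2] at hy
        refine (norm_sum_le_of_le (f := fun b => K x y a b * volterraTerm K g m t y b)
          (n := fun _ => B * (max M 0 * Real.exp θ * (1 / 2) ^ m))
          Finset.univ fun b _ => ?_).trans ?_
        · rw [norm_mul]
          refine mul_le_mul (hB x y hx.1 hy.1.le hy.2 a b) ?_ (abs_nonneg _) hB0.le
          refine (hbd t _ (le_max_right _ _) hM' m y b).trans ?_
          gcongr
          nlinarith [hx.1, hy.1]
        · rw [Finset.sum_const, nsmul_eq_mul, Finset.card_univ]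
          exact le_of_eq (by ring)
      · exact Filter.Eventually.of_forall fun y _ =>
          (summable_geometric_of_lt_one (by norm_num) (by norm_num)).mul_left _
      · refine Filter.Eventually.of_forall fun y _ => ?_
        simp only [Matrix.mulVec, dotProduct]
        exact hasSum_sum fun b _ => (hsum t y b).hasSum.mul_left _
    -- Splitting off the zeroth term leaves minus the integral operator applied to the whole series,
    -- which is the Volterra equation.
    have h0 := (hsum t x a).tsum_eq_zero_add
    have h1 : ∀ m, volterraTerm K g (m + 1) t x a =
        -∫ y in x..1, (K x y).mulVec (volterraTerm K g m t y) a := fun m => by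
      rw [volterraTerm, if_pos hx]
    simp only [h1] at h0
    rw [hint.neg.tsum_eq, volterraTerm, if_pos hx] at h0
    change g t x a = (∑' m, volterraTerm K g m t x a) + _
    rw [h0]
    ring

end Volterra

/-! ### `L²` estimates for scalar transport equations, in extended nonnegative integrals. -/

lemma sq_lintegral_le {α : Type*} [MeasurableSpace α] (μ : Measure α) {f : α → ENNReal}
    (hf : AEMeasurable f μ) : (∫⁻ x, f x ∂μ) ^ 2 ≤ μ univ * ∫⁻ x, f x ^ 2 ∂μ := by
  have h := ENNReal.lintegral_mul_le_Lp_mul_Lq μ (p := 2) (q := 2)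
    (Real.holderConjugate_iff.2 ⟨by norm_num, by norm_num⟩) hf (g := fun _ => 1) aemeasurable_const
  simp only [Pi.mul_apply, mul_one, ENNReal.rpow_two, one_pow, lintegral_one] at h
  calc (∫⁻ x, f x ∂μ) ^ 2
      ≤ ((∫⁻ x, f x ^ 2 ∂μ) ^ (1 / 2 : ℝ) * μ univ ^ (1 / 2 : ℝ)) ^ 2 := pow_le_pow_left' h 2
    _ = μ univ * ∫⁻ x, f x ^ 2 ∂μ := by
      rw [mul_pow, ← ENNReal.rpow_two, ← ENNReal.rpow_two, ← ENNReal.rpow_mul, ← ENNReal.rpow_mul]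
      norm_num [mul_comm]

lemma enorm_sq (x : ℝ) : ‖x‖ₑ ^ 2 = ENNReal.ofReal (x ^ 2) := by
  rw [Real.enorm_eq_ofReal_abs, ← ENNReal.ofReal_pow (abs_nonneg _), sq_abs]

lemma ofReal_sq_intervalIntegral_le {g : ℝ → ℝ} {σ : ℝ} (hσ : 0 ≤ σ) (hg : Measurable g) :
    ENNReal.ofReal ((∫ r in (0 : ℝ)..σ, g r) ^ 2) ≤
      ENNReal.ofReal σ * ∫⁻ r in Ioc 0 σ, ENNReal.ofReal (g r ^ 2) := by
  rw [← enorm_sq, intervalIntegral.integral_of_le hσ]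
  calc ‖∫ r in Ioc 0 σ, g r‖ₑ ^ 2 ≤ (∫⁻ r in Ioc 0 σ, ‖g r‖ₑ) ^ 2 := by
        gcongr; exact enorm_integral_le_lintegral_enorm _
    _ ≤ _ := sq_lintegral_le _ hg.enorm.aemeasurable
    _ = _ := by simp [enorm_sq]

lemma ofReal_sq_add_le (a b : ℝ) : ENNReal.ofReal ((a + b) ^ 2) ≤
    2 * ENNReal.ofReal (a ^ 2) + 2 * ENNReal.ofReal (b ^ 2) := by
  rw [show (2 : ENNReal) = ENNReal.ofReal 2 by simp, ← ENNReal.ofReal_mul (by norm_num),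
    ← ENNReal.ofReal_mul (by norm_num), ← ENNReal.ofReal_add (by positivity) (by positivity)]
  exact ENNReal.ofReal_le_ofReal (by nlinarith [sq_nonneg (a - b)])

lemma ofReal_sq_mulVec_le {ι κ : Type*} [Fintype ι] (A : Matrix κ ι ℝ) {B : ℝ}
    (k : κ) (hA : ∀ l, |A k l| ≤ B) (v : ι → ℝ) :
    ENNReal.ofReal (A.mulVec v k ^ 2) ≤
      ENNReal.ofReal (Fintype.card ι * B ^ 2) * ∑ l, ENNReal.ofReal (v l ^ 2) := by
  rw [← ENNReal.ofReal_sum_of_nonneg fun l _ => sq_nonneg (v l),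
    ← ENNReal.ofReal_mul (by positivity)]
  refine ENNReal.ofReal_le_ofReal ?_
  have h1 := sq_sum_le_card_mul_sum_sq (s := Finset.univ) (f := fun l => A k l * v l)
  rw [Finset.card_univ] at h1
  refine h1.trans ?_
  rw [mul_assoc, Finset.mul_sum _ _ (B ^ 2)]
  have h2 : ∑ l, (A k l * v l) ^ 2 ≤ ∑ l, B ^ 2 * v l ^ 2 := by
    refine Finset.sum_le_sum fun l _ => ?_
    rw [mul_pow, ← sq_abs (A k l)]
    have := hA l
    gcongr
  exact mul_le_mul_of_nonneg_left h2 (Nat.cast_nonneg (Fintype.card ι))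

lemma lintegral_comp_mul_add {f : ℝ → ENNReal} (hf : Measurable f) {c : ℝ} (hc : c ≠ 0) (a : ℝ) :
    ∫⁻ x, f (c * x + a) = ENNReal.ofReal |c⁻¹| * ∫⁻ x, f x := by
  rw [← lintegral_add_right_eq_self f a, ← lintegral_map (f := fun x => f (x + a))
    (g := fun x => c * x) (by fun_prop) (by fun_prop), Real.map_volume_mul_left hc,
    lintegral_smul_measure, smul_eq_mul]

section Transport

variable {f g : ℝ → ℝ → ℝ} {b : ℝ → ℝ} {c T t₁ : ℝ}

/-- Pointwise bound for a solution of `∂ₜ f + c ∂ₓ f = g`, `f(t,0) = b(t)`, in terms of data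
extended by zero. -/
lemma transport_sq_le (hc : 0 < c)
    (hf : ∀ t x s, T ≤ t → 0 ≤ x → 0 ≤ s → x + c * s ≤ 1 →
      f (t + s) (x + c * s) = f t x + ∫ r in (0 : ℝ)..s, g (t + r) (x + c * r))
    (hb : ∀ t, T < t → f t 0 = b t) (hg : Measurable fun p : ℝ × ℝ => g p.1 p.2)
    {s x : ℝ} (hs : s ∈ Icc T t₁) (hx : x ∈ Icc (0 : ℝ) 1) :
    ENNReal.ofReal (f s x ^ 2) ≤
      2 * ((Icc 0 1).indicator (fun y => ENNReal.ofReal (f T y ^ 2)) (x - c * (s - T))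
        + (Ioc T t₁).indicator (fun r => ENNReal.ofReal (b r ^ 2)) (s - x / c))
      + 2 * (ENNReal.ofReal (t₁ - T) * ∫⁻ r in Ioc 0 (t₁ - T),
        (Icc T t₁ ×ˢ Icc 0 1).indicator (fun p : ℝ × ℝ => ENNReal.ofReal (g p.1 p.2 ^ 2))
          (s - r, x - c * r)) := by
  obtain ⟨hs1, hs2⟩ := hs
  obtain ⟨hx0, hx1⟩ := hx
  have hxc : 0 ≤ x / c := div_nonneg hx0 hc.le
  -- The backward characteristic stops after time `σ`, either on the initial line or at the inlet.
  -- Extending the data by zero lets a single sum cover both cases and makes translations and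
  -- scalings of the whole line available afterwards.
  set σ := min (s - T) (x / c) with hσ
  have hσ0 : 0 ≤ σ := le_min (by linarith) hxc
  have hσT : σ ≤ s - T := min_le_left _ _
  have hσx : c * σ ≤ x := by
    have := mul_le_mul_of_nonneg_left (min_le_right (s - T) (x / c)) hc.le
    rwa [mul_div_cancel₀ _ hc.ne'] at this
  have e := hf (s - σ) (x - c * σ) σ (by linarith) (by linarith) hσ0 (by linarith)
  rw [sub_add_cancel, sub_add_cancel] at e
  have e2 : ∫ r in (0 : ℝ)..σ, g (s - σ + r) (x - c * σ + c * r)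
      = ∫ r in (0 : ℝ)..σ, g (s - r) (x - c * r) := by
    have := intervalIntegral.integral_comp_sub_left (a := 0) (b := σ)
      (fun r => g (s - r) (x - c * r)) σ
    rw [sub_self, sub_zero] at this
    rw [← this]
    refine intervalIntegral.integral_congr fun r _ => ?_
    rw [show s - (σ - r) = s - σ + r by ring, show x - c * (σ - r) = x - c * σ + c * r by ring]
  rw [e, e2]
  refine (ofReal_sq_add_le _ _).trans (add_le_add (mul_le_mul_right ?_ _) (mul_le_mul_right ?_ _))
  · rcases le_or_gt (s - T) (x / c) with h | h
    · have hσ' : σ = s - T := min_eq_left h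
      rw [hσ', indicator_of_mem (s := Icc (0 : ℝ) 1), sub_sub_cancel]
      · exact le_self_add
      · rw [hσ'] at hσx
        exact ⟨by linarith, by nlinarith⟩
    · have hσ' : σ = x / c := min_eq_right h.le
      rw [hσ', mul_div_cancel₀ _ hc.ne', sub_self, hb _ (by linarith),
        indicator_of_mem (s := Ioc T t₁)]
      · exact le_add_self
      · exact ⟨by linarith, by linarith⟩
  · refine (ofReal_sq_intervalIntegral_le hσ0
      (hg.comp (by fun_prop : Measurable fun r : ℝ => (s - r, x - c * r)))).trans ?_
    refine mul_le_mul' (ENNReal.ofReal_le_ofReal (by linarith)) ?_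
    refine le_trans ?_ (lintegral_mono_set (Ioc_subset_Ioc_right (by linarith : σ ≤ t₁ - T)))
    refine setLIntegral_mono' measurableSet_Ioc fun r hr => ?_
    have h2 : c * r ≤ c * σ := mul_le_mul_of_nonneg_left hr.2 hc.le
    have h3 : 0 ≤ c * r := mul_nonneg hc.le hr.1.le
    have hmem : (s - r, x - c * r) ∈ Icc T t₁ ×ˢ Icc (0 : ℝ) 1 := by
      refine ⟨⟨?_, ?_⟩, ⟨?_, ?_⟩⟩ <;> simp only <;> linarith [hr.1, hr.2]
    rw [indicator_of_mem hmem]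
    rfl

lemma lintegral_indicator_prod (F : ℝ × ℝ → ENNReal) {A C : Set ℝ} (hA : MeasurableSet A)
    (hC : MeasurableSet C) :
    ∫⁻ s, ∫⁻ x, (A ×ˢ C).indicator F (s, x) = ∫⁻ s in A, ∫⁻ x in C, F (s, x) := by
  rw [← lintegral_indicator hA]
  refine lintegral_congr fun s => ?_
  by_cases h : s ∈ A
  · rw [indicator_of_mem h, ← lintegral_indicator hC]
    refine lintegral_congr fun x => ?_
    by_cases h' : x ∈ C <;> simp [h, h']
  · simp [h]

/-- `L²` bound at a later time for `∂ₜ f + c ∂ₓ f = g`, `f(t,0) = b(t)`. -/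
lemma transport_lintegral_sq_le (hc : 0 < c)
  (hf : ∀ t x s, T ≤ t → 0 ≤ x → 0 ≤ s → x + c * s ≤ 1 →
    f (t + s) (x + c * s) = f t x + ∫ r in (0 : ℝ)..s, g (t + r) (x + c * r))
  (hb : ∀ t, T < t → f t 0 = b t) (hg : Measurable fun p : ℝ × ℝ => g p.1 p.2)
  (hfm : Measurable fun x => f T x) (hbm : Measurable b)
  (ht : T ≤ t₁) :
    ∫⁻ x in Icc 0 1, ENNReal.ofReal (f t₁ x ^ 2) ≤
      2 * ((∫⁻ x in Icc 0 1, ENNReal.ofReal (f T x ^ 2))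
        + ENNReal.ofReal c * ∫⁻ s in Ioc T t₁, ENNReal.ofReal (b s ^ 2))
      + 2 * (ENNReal.ofReal (t₁ - T) *
        ∫⁻ s in Icc T t₁, ∫⁻ x in Icc 0 1, ENNReal.ofReal (g s x ^ 2)) := by
  set fh := (Icc (0 : ℝ) 1).indicator (fun y => ENNReal.ofReal (f T y ^ 2)) with hfh
  set bh := (Ioc T t₁).indicator (fun r => ENNReal.ofReal (b r ^ 2)) with hbh
  set gh := (Icc T t₁ ×ˢ Icc (0 : ℝ) 1).indicator
    (fun p : ℝ × ℝ => ENNReal.ofReal (g p.1 p.2 ^ 2)) with hgh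
  have mf : Measurable fh := (hfm.pow_const 2).ennreal_ofReal.indicator measurableSet_Icc
  have mb : Measurable bh := (hbm.pow_const 2).ennreal_ofReal.indicator measurableSet_Ioc
  have mg : Measurable gh := (hg.pow_const 2).ennreal_ofReal.indicator
    (measurableSet_Icc.prod measurableSet_Icc)
  have h1 : ∫⁻ x in Icc 0 1, ENNReal.ofReal (f t₁ x ^ 2) ≤
      ∫⁻ x, (2 * (fh (x - c * (t₁ - T)) + bh (t₁ - x / c))
      + 2 * (ENNReal.ofReal (t₁ - T) * ∫⁻ r in Ioc 0 (t₁ - T), gh (t₁ - r, x - c * r))) :=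
    (setLIntegral_mono' measurableSet_Icc fun x hx =>
      transport_sq_le hc hf hb hg ⟨ht, le_rfl⟩ hx).trans (setLIntegral_le_lintegral _ _)
  have mG : Measurable fun x : ℝ => ∫⁻ r in Ioc 0 (t₁ - T), gh (t₁ - r, x - c * r) :=
    (mg.comp (by fun_prop : Measurable fun q : ℝ × ℝ =>
      (t₁ - q.2, q.1 - c * q.2))).lintegral_prod_right'
  -- At a fixed time the inlet data are read at `t₁ - x / c`, so the change from position to time
  -- costs the factor `c`. The initial data and, after Tonelli, the source are only translated in
  -- `x`.
  have hB : ∫⁻ x, bh (t₁ - x / c) = ENNReal.ofReal c * ∫⁻ x, bh x := by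
    have := lintegral_comp_mul_add mb (c := -c⁻¹) (by simpa using hc.ne') t₁
    rw [show |(-c⁻¹)⁻¹| = c by simp [abs_of_pos hc]] at this
    rw [← this]
    refine lintegral_congr fun x => ?_
    congr 1
    field_simp; ring
  refine h1.trans (le_of_eq ?_ |>.trans (add_le_add (le_refl _) (mul_le_mul_right
    (mul_le_mul_right (?_ : ∫⁻ r in Ioc 0 (t₁ - T), ∫⁻ x, gh (t₁ - r, x) ≤ _) _) _)))
  · rw [lintegral_add_left (by fun_prop), lintegral_const_mul _ (by fun_prop),
      lintegral_add_left (by fun_prop), lintegral_const_mul _ (by fun_prop),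
      lintegral_const_mul _ mG]
    rw [lintegral_sub_right_eq_self fh, hB, lintegral_lintegral_swap, hfh, hbh,
      lintegral_indicator measurableSet_Icc, lintegral_indicator measurableSet_Ioc]
    · congr 3
      refine lintegral_congr fun r => ?_
      exact lintegral_sub_right_eq_self (fun x => gh (t₁ - r, x)) (c * r)
    · exact (mg.comp (by fun_prop : Measurable fun q : ℝ × ℝ =>
        (t₁ - q.2, q.1 - c * q.2))).aemeasurable
  · refine (setLIntegral_le_lintegral _ _).trans (le_of_eq ?_)
    rw [lintegral_sub_left_eq_self (fun s => ∫⁻ x, gh (s, x)) t₁, hgh,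
      lintegral_indicator_prod _ measurableSet_Icc measurableSet_Icc]

/-- `L²` bound at the outlet for `∂ₜ f + c ∂ₓ f = g`, `f(t,0) = b(t)`. -/
lemma transport_outlet_lintegral_sq_le (hc : 0 < c)
  (hf : ∀ t x s, T ≤ t → 0 ≤ x → 0 ≤ s → x + c * s ≤ 1 →
    f (t + s) (x + c * s) = f t x + ∫ r in (0 : ℝ)..s, g (t + r) (x + c * r))
  (hb : ∀ t, T < t → f t 0 = b t) (hg : Measurable fun p : ℝ × ℝ => g p.1 p.2)
  (hfm : Measurable fun x => f T x) (hbm : Measurable b) :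
    ∫⁻ s in Icc T t₁, ENNReal.ofReal (f s 1 ^ 2) ≤
      2 * (ENNReal.ofReal c⁻¹ * (∫⁻ x in Icc 0 1, ENNReal.ofReal (f T x ^ 2))
        + ∫⁻ s in Ioc T t₁, ENNReal.ofReal (b s ^ 2))
      + 2 * (ENNReal.ofReal (t₁ - T) * (ENNReal.ofReal c⁻¹ *
        ∫⁻ s in Icc T t₁, ∫⁻ x in Icc 0 1, ENNReal.ofReal (g s x ^ 2))) := by
  set fh := (Icc (0 : ℝ) 1).indicator (fun y => ENNReal.ofReal (f T y ^ 2)) with hfh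
  set bh := (Ioc T t₁).indicator (fun r => ENNReal.ofReal (b r ^ 2)) with hbh
  set gh := (Icc T t₁ ×ˢ Icc (0 : ℝ) 1).indicator
    (fun p : ℝ × ℝ => ENNReal.ofReal (g p.1 p.2 ^ 2)) with hgh
  have mf : Measurable fh := (hfm.pow_const 2).ennreal_ofReal.indicator measurableSet_Icc
  have mb : Measurable bh := (hbm.pow_const 2).ennreal_ofReal.indicator measurableSet_Ioc
  have mg : Measurable gh := (hg.pow_const 2).ennreal_ofReal.indicator
    (measurableSet_Icc.prod measurableSet_Icc)
  have h1 : ∫⁻ s in Icc T t₁, ENNReal.ofReal (f s 1 ^ 2) ≤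
      ∫⁻ s, (2 * (fh (1 - c * (s - T)) + bh (s - 1 / c))
      + 2 * (ENNReal.ofReal (t₁ - T) * ∫⁻ r in Ioc 0 (t₁ - T), gh (s - r, 1 - c * r))) :=
    (setLIntegral_mono' measurableSet_Icc fun s hs =>
      transport_sq_le hc hf hb hg hs ⟨zero_le_one, le_rfl⟩).trans (setLIntegral_le_lintegral _ _)
  have mG : Measurable fun s : ℝ => ∫⁻ r in Ioc 0 (t₁ - T), gh (s - r, 1 - c * r) :=
    (mg.comp (by fun_prop : Measurable fun q : ℝ × ℝ =>
      (q.1 - q.2, 1 - c * q.2))).lintegral_prod_right'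
  -- At the outlet the roles are reversed: the integral runs over time, inlet data are only
  -- translated, and the initial data pick up the factor `1 / c`, as does the source through `1 - c
  -- * r`.
  have hA : ∫⁻ s, fh (1 - c * (s - T)) = ENNReal.ofReal c⁻¹ * ∫⁻ x, fh x := by
    have := lintegral_comp_mul_add mf (c := -c) (by simpa using hc.ne') (1 + c * T)
    rw [show |(-c)⁻¹| = c⁻¹ by rw [inv_neg, abs_neg, abs_of_pos (inv_pos.2 hc)]] at this
    rw [← this]
    refine lintegral_congr fun x => ?_
    congr 1
    ring
  refine h1.trans (le_of_eq ?_ |>.trans (add_le_add (le_refl _) (mul_le_mul_right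
    (mul_le_mul_right (?_ : ∫⁻ r in Ioc 0 (t₁ - T), ∫⁻ s, gh (s, 1 - c * r) ≤ _) _) _)))
  · rw [lintegral_add_left (by fun_prop), lintegral_const_mul _ (by fun_prop),
      lintegral_add_left (by fun_prop), lintegral_const_mul _ (by fun_prop),
      lintegral_const_mul _ mG]
    rw [lintegral_sub_right_eq_self bh, hA, lintegral_lintegral_swap, hfh, hbh,
      lintegral_indicator measurableSet_Icc, lintegral_indicator measurableSet_Ioc]
    · congr 3
      refine lintegral_congr fun r => ?_
      exact lintegral_sub_right_eq_self (fun s => gh (s, 1 - c * r)) r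
    · exact (mg.comp (by fun_prop : Measurable fun q : ℝ × ℝ =>
        (q.1 - q.2, 1 - c * q.2))).aemeasurable
  · refine (setLIntegral_le_lintegral _ _).trans (le_of_eq ?_)
    have mS : Measurable fun y : ℝ => ∫⁻ s, gh (s, y) :=
      (mg.comp measurable_swap).lintegral_prod_right'
    have := lintegral_comp_mul_add mS (c := -c) (by simpa using hc.ne') 1
    rw [show |(-c)⁻¹| = c⁻¹ by rw [inv_neg, abs_neg, abs_of_pos (inv_pos.2 hc)]] at this
    simp only [show ∀ r : ℝ, -c * r + 1 = 1 - c * r from fun r => by ring] at this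
    rw [this, lintegral_lintegral_swap (by exact (mg.comp measurable_swap).aemeasurable), hgh,
      lintegral_indicator_prod _ measurableSet_Icc measurableSet_Icc]

end Transport

/-! ### The control law and the tracking identity. -/

/-- The nearest point of `[0,1]`. -/
def clamp (x : ℝ) : ℝ := max 0 (min x 1)

lemma clamp_mem (x : ℝ) : clamp x ∈ Icc (0 : ℝ) 1 :=
  ⟨le_max_left _ _, max_le zero_le_one (min_le_right _ _)⟩

lemma clamp_eq {x : ℝ} (hx : x ∈ Icc (0 : ℝ) 1) : clamp x = x := by
  rw [clamp, min_eq_left hx.2, max_eq_right hx.1]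

lemma continuous_clamp : Continuous clamp := by unfold clamp; fun_prop

namespace Chain

variable {S : Chain} {i : ℕ}

lemma inv_lam_le_tr (hi : i < S.N) (k : Fin (S.n i)) : (S.lam i k)⁻¹ ≤ S.tr i :=
  inv_anti₀ (S.lam_pos i hi _) ((S.lam_strictMono i hi).monotone (Nat.zero_le k.val))

lemma inv_mu_le_tl (hi : i < S.N) (k : Fin (S.m i)) : (S.mu i k)⁻¹ ≤ S.tl i :=
  inv_anti₀ (S.mu_pos i hi _) ((S.mu_strictMono i hi).monotone (Nat.zero_le k.val))

lemma tr_pos (hi : i < S.N) : 0 < S.tr i := inv_pos.2 (S.lam_pos i hi _)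

lemma tl_pos (hi : i < S.N) : 0 < S.tl i := inv_pos.2 (S.mu_pos i hi _)

lemma memory_nonneg (hi : i < S.N) : 0 ≤ S.memory i := by
  cases i with
  | zero => exact le_rfl
  | succ k => exact (tr_pos (by omega)).le

lemma delay_nonneg (hi : i < S.N) : 0 ≤ S.delay i :=
  Finset.sum_nonneg fun j hj => (tr_pos (by have := Finset.mem_range.1 hj; omega)).le

namespace Kernels

variable (κ : S.Kernels)

/-- `Gᵢ`, extended to `ℝ` by its values at `0` and `1`. -/
def clampG (i : ℕ) (x : ℝ) : Matrix (Fin (S.n i)) (Fin (S.n i)) ℝ := S.G i (κ.K i) (clamp x)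

lemma clampG_eq {x : ℝ} (hx : x ∈ Icc (0 : ℝ) 1) : κ.clampG i x = S.G i (κ.K i) x := by
  rw [clampG, clamp_eq hx]

lemma clampG_of_not_lt (x : ℝ) (k l : Fin (S.n i)) (h : ¬ k < l) : κ.clampG i x k l = 0 := by
  simp [clampG, G, h]

lemma measurable_clampG (hi : i < S.N) (k l : Fin (S.n i)) :
    Measurable fun x => κ.clampG i x k l := by
  by_cases h : k < l
  · simp only [clampG, G, Matrix.of_apply, h, if_true]
    refine Measurable.add (Continuous.measurable ?_) (measurable_const.mul
      ((κ.K_meas i hi _ _).comp (continuous_clamp.measurable.prodMk continuous_clamp.measurable)))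
    exact (S.Sig_cont i hi _ _).comp_continuous continuous_clamp clamp_mem
  · simp only [clampG, G, Matrix.of_apply, h, if_false]
    exact measurable_const

lemma exists_bound_clampG (hi : i < S.N) : ∃ B, ∀ x k l, |κ.clampG i x k l| ≤ B := by
  obtain ⟨BK, hBK⟩ := κ.K_bdd i hi
  obtain ⟨B, -, hB⟩ := exists_uniform_bound (ι := Fin (S.n i) × Fin (S.n i))
    (P := fun p B => ∀ x, |κ.clampG i x p.1 p.2| ≤ B) (fun p B B' h hP x => (hP x).trans h)
    (fun ⟨k, l⟩ => by
      by_cases h : k < l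
      · obtain ⟨BS, hBS⟩ := isCompact_Icc.exists_bound_of_continuousOn
          (S.Sig_cont i hi (Sum.inl k) (Sum.inl l))
        refine ⟨BS + |S.lam i l - S.lam i k| * BK, fun x => ?_⟩
        simp only [clampG, G, Matrix.of_apply, h, if_true]
        refine (abs_add_le _ _).trans (add_le_add (hBS _ (clamp_mem x)) ?_)
        rw [abs_mul]
        exact mul_le_mul_of_nonneg_left (hBK _ _ (clamp_mem x).1 le_rfl (clamp_mem x).2 _ _)
          (abs_nonneg _)
      · exact ⟨0, fun x => by rw [κ.clampG_of_not_lt x k l h, abs_zero]⟩)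
  exact ⟨B, fun x k l => hB (k, l) x⟩

/-- The control law: the reference is transported back from `x = 1` to `x = 0`, and the boundary
terms at `x = 0` are cancelled by means of the predictions. -/
def controlLaw (hi : i < S.N) : ControlLaw S i where
  -- The input applied at `t` reaches the inlet at `t + S.delay i`, so the transported reference is
  -- evaluated at that later time.
  ff ζ t k := triSolve (S.lam i) (κ.clampG i) 1 ζ k (t + S.delay i) 0
  -- Apart from the input, this is minus the right-hand side of `bc_α` at time `t + S.delay i`, with
  -- predictions in place of the states.
  fb Pz _ t j := -((S.Q i).mulVec (fun k => Pz t 0 (Sum.inr k)) j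
    + (∫ y in (0 : ℝ)..1, (κ.K i 0 y).mulVec (Pz t y) (Sum.inl j))
    - ∫ y in (0 : ℝ)..S.memory i, (κ.QF i y).mulVec (fun k => Pz (t - y) 0 (Sum.inr k)) j)
  ff_local ζ ζ' t h := by
    funext k
    exact triSolve_one_congr (S.lam_pos i hi) (inv_lam_le_tr hi) h k zero_le_one le_rfl
      (by simp)
  fb_causal Pz Pγ Pz' Pγ' t h := by
    have hm := memory_nonneg hi
    have h0 : ∀ x ∈ Icc (0 : ℝ) 1, Pz t x = Pz' t x := fun x hx =>
      (h t ⟨by linarith, le_rfl⟩ x hx).1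
    funext j
    rw [h0 0 ⟨le_rfl, zero_le_one⟩]
    congr 2
    · congr 1
      refine intervalIntegral.integral_congr fun y hy => ?_
      rw [uIcc_of_le zero_le_one] at hy
      rw [h0 y hy]
    · refine intervalIntegral.integral_congr fun y hy => ?_
      rw [uIcc_of_le hm] at hy
      rw [(h (t - y) ⟨by linarith [hy.2], by linarith [hy.1]⟩ 0 ⟨le_rfl, zero_le_one⟩).1]

variable {κ} {t₀ : ℝ} {U : ℝ → Fin (S.n i) → ℝ} {w : ℝ → Fin (S.m (i + 1)) → ℝ}
  {z γ : ℝ → ℝ → S.Idx i → ℝ}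

lemma IsTrajectory.pde_clampG (h : κ.IsTrajectory i t₀ U w z γ) (hi : i < S.N) (j : Fin (S.n i))
    {t x s : ℝ} (ht : t₀ ≤ t) (hx : 0 ≤ x) (hs : 0 ≤ s) (hxs : x + S.lam i j * s ≤ 1) :
    γ (t + s) (x + S.lam i j * s) (Sum.inl j) = γ t x (Sum.inl j) +
      ∫ r in (0 : ℝ)..s, (κ.clampG i (x + S.lam i j * r)).mulVec
        (fun k => γ (t + r) (x + S.lam i j * r) (Sum.inl k)) j := by
  rw [h.pde_α j t x s ht hx hs hxs]
  congr 1
  refine intervalIntegral.integral_congr fun r hr => ?_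
  rw [uIcc_of_le hs] at hr
  have hj := S.lam_pos i hi j
  rw [κ.clampG_eq ⟨by nlinarith [hr.1], by nlinarith [hr.2]⟩]

/-- Under the law, the transported reference is the boundary value of `αᵢ`. -/
lemma IsTrajectory.inlet_eq (h : κ.IsTrajectory i t₀ U w z γ) (hi : i < S.N)
    {ζ : ℝ → Fin (S.n i) → ℝ} {Pz Pγ : ℝ → ℝ → S.Idx i → ℝ}
    (hP : IsPrediction (S.delay i) t₀ Pz z)
    (hU : (κ.controlLaw hi).Drives (t₀ + S.memory i) ζ Pz Pγ U) (j : Fin (S.n i)) {t : ℝ}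
    (ht : t₀ + S.memory i + S.delay i < t) :
    γ t 0 (Sum.inl j) = triSolve (S.lam i) (κ.clampG i) 1 ζ j t 0 := by
  have hm := memory_nonneg hi
  have hd := delay_nonneg hi
  have h1 : ∫ y in (0 : ℝ)..1, (κ.K i 0 y).mulVec (Pz (t - S.delay i) y) (Sum.inl j) =
      ∫ y in (0 : ℝ)..1, (κ.K i 0 y).mulVec (z t y) (Sum.inl j) := by
    refine intervalIntegral.integral_congr fun y hy => ?_
    rw [uIcc_of_le zero_le_one] at hy
    rw [hP _ (by linarith) y hy, sub_add_cancel]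
  have h2 : ∫ y in (0 : ℝ)..S.memory i,
      (κ.QF i y).mulVec (fun k => Pz (t - S.delay i - y) 0 (Sum.inr k)) j =
      ∫ y in (0 : ℝ)..S.memory i, (κ.QF i y).mulVec (fun k => z (t - y) 0 (Sum.inr k)) j := by
    refine intervalIntegral.integral_congr fun y hy => ?_
    rw [uIcc_of_le hm] at hy
    -- The law looks back over `S.memory i` and predictions are exact only after `t₀`; switching on
    -- at `t₀ + S.memory i` keeps every time used here beyond `t₀`.
    rw [hP _ (by linarith [hy.2]) 0 ⟨le_rfl, zero_le_one⟩,
      show t - S.delay i - y + S.delay i = t - y by ring]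
  rw [h.bc_α t (by linarith) j, hU _ (by linarith)]
  simp only [Pi.add_apply, controlLaw]
  rw [h1, h2, hP _ (by linarith) 0 ⟨le_rfl, zero_le_one⟩, sub_add_cancel]
  ring

/-- Under the law, `αᵢ` is the transported reference wherever the backward characteristics reach
`x = 0` after the law has taken effect. -/
lemma IsTrajectory.eq_triSolve (h : κ.IsTrajectory i t₀ U w z γ) (hi : i < S.N) (ht₀ : 0 ≤ t₀)
    {ζ d : ℝ → Fin (S.n i) → ℝ} {Pz Pγ : ℝ → ℝ → S.Idx i → ℝ}
    (hP : IsPrediction (S.delay i) t₀ Pz z)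
    (hU : (κ.controlLaw hi).Drives (t₀ + S.memory i) ζ Pz Pγ U)
    (hdζ : ∀ t, 0 ≤ t → d t = ζ t) (hdm : ∀ k, Measurable fun t => d t k)
    (hdb : ∀ R : ℝ, ∃ B : ℝ, ∀ t k, |t| ≤ R → |d t k| ≤ B) (k : Fin (S.n i)) {t x : ℝ}
    (hx : x ∈ Icc (0 : ℝ) 1) (ht : t₀ + S.memory i + S.delay i < t - x * S.tr i) :
    γ t x (Sum.inl k) = triSolve (S.lam i) (κ.clampG i) 1 d k t x := by
  have hm := memory_nonneg hi
  have hd := delay_nonneg hi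
  obtain ⟨BG, hBG⟩ := κ.exists_bound_clampG hi
  refine triangular_unique (a := fun k t x => γ t x (Sum.inl k)) (S.lam_pos i hi)
    κ.clampG_of_not_lt (inv_lam_le_tr hi) (fun k t ht => ?_) (fun k t s ht hs hs' => ?_)
    (fun k t s _ _ _ => ?_) k hx.1 hx.2 ht
  · refine (h.inlet_eq hi hP hU k ht).trans ?_
    -- The law uses `ζ` only at nonnegative times, so it may be replaced by `d`, which is measurable
    -- and locally bounded on the whole line as `triSolve_pde` requires.
    exact triSolve_one_congr (S.lam_pos i hi) (inv_lam_le_tr hi) (t₀ := t) (t₁ := t + S.tr i)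
      (fun s hs => (hdζ s (by linarith [hs.1])).symm) k zero_le_one le_rfl (by simp)
  · have := h.pde_clampG hi k (t := t) (x := 0) (s := s) (by linarith) le_rfl hs (by linarith)
    simpa only [zero_add] using this
  · have := triSolve_pde (x₀ := 1) (κ.measurable_clampG hi) hBG κ.clampG_of_not_lt hdm hdb
      (S.lam_pos i hi k).ne' t 0 s
    simpa only [zero_add] using this

end Kernels

end Chain

/-- The reference is regular only on `[0, ∞)`, whereas `triSolve` is studied for data on all of `ℝ`;
freezing the value at `0` supplies such data. -/
lemma exists_extension_of_continuousOn {d : ℕ} {ζ : ℝ → Fin d → ℝ} (hζ : ContinuousOn ζ (Ici 0)) :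
    ∃ ζ' : ℝ → Fin d → ℝ, (∀ t, 0 ≤ t → ζ' t = ζ t) ∧ (∀ k, Measurable fun t => ζ' t k) ∧
      ∀ R : ℝ, ∃ B : ℝ, ∀ t k, |t| ≤ R → |ζ' t k| ≤ B := by
  have hc : Continuous fun t => ζ (max t 0) :=
    hζ.comp_continuous (by fun_prop) fun t => mem_Ici.2 (le_max_right _ _)
  refine ⟨fun t => ζ (max t 0), fun t ht => congrArg ζ (max_eq_left ht),
    fun k => ((continuous_apply k).comp hc).measurable, fun R => ?_⟩
  obtain ⟨B, hB⟩ := (isCompact_Icc (a := -R) (b := R)).exists_bound_of_continuousOn hc.continuousOn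
  exact ⟨B, fun t k ht => (norm_le_pi_norm (ζ (max t 0)) k).trans (hB t (abs_le.1 ht))⟩

/-! ### Leftward transport from data at `x = 1`. -/

/-- Solution of `∂ₜ f - c ∂ₓ f = src`, `f(t,1) = b(t)`, integrated along the characteristics that
pass through `x = 1`. -/
def leftSolve (c : ℝ) (src : ℝ → ℝ → ℝ) (b : ℝ → ℝ) (t x : ℝ) : ℝ :=
  b (t - (1 - x) / c) + ∫ r in (0 : ℝ)..(1 - x) / c, src (t - (1 - x) / c + r) (1 - c * r)

section LeftSolve

variable {c : ℝ} {src : ℝ → ℝ → ℝ} {b : ℝ → ℝ}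

lemma leftSolve_one (t : ℝ) : leftSolve c src b t 1 = b t := by simp [leftSolve]

lemma measurable_leftSolve (hs : Measurable fun p : ℝ × ℝ => src p.1 p.2) (hb : Measurable b) :
    Measurable fun p : ℝ × ℝ => leftSolve c src b p.1 p.2 := by
  refine (hb.comp (by fun_prop)).add (measurable_intervalIntegral (f := fun q : (ℝ × ℝ) × ℝ =>
    src (q.1.1 - (1 - q.1.2) / c + q.2) (1 - c * q.2)) ?_ (by fun_prop) (by fun_prop))
  exact hs.comp (by fun_prop : Measurable fun q : (ℝ × ℝ) × ℝ =>
    (q.1.1 - (1 - q.1.2) / c + q.2, 1 - c * q.2))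

lemma locBdd_leftSolve (hs : LocBdd src) (hb : ∀ R : ℝ, ∃ B : ℝ, ∀ t, |t| ≤ R → |b t| ≤ B) :
    LocBdd (leftSolve c src b) := by
  intro R
  set a := (1 + R) / |c| with ha
  obtain ⟨Bb, hBb⟩ := hb (R + a)
  obtain ⟨B, hB⟩ := hs (max (R + a + a) (1 + |c| * a))
  refine ⟨Bb + max B 0 * a, fun t x ht hx => ?_⟩
  have h1 : |(1 - x) / c| ≤ a := by
    rw [abs_div]
    exact div_le_div_of_nonneg_right ((abs_sub _ _).trans (by simpa using hx)) (abs_nonneg _)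
  refine (abs_add_le _ _).trans (add_le_add (hBb _ ?_) ?_)
  · exact (abs_sub _ _).trans (by linarith)
  rw [← Real.norm_eq_abs]
  refine (intervalIntegral.norm_integral_le_of_norm_le_const (C := max B 0)
    fun r hr => ?_).trans ?_
  · have hr' : |r| ≤ a := by
      have := abs_sub_left_of_mem_uIcc (uIoc_subset_uIcc hr)
      simpa using this.trans (by simpa using h1)
    refine (hB _ _ ?_ ?_).trans (le_max_left _ _)
    · refine le_trans ?_ (le_max_left _ _)
      refine (abs_add_le _ _).trans (add_le_add ((abs_sub _ _).trans ?_) hr')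
      linarith
    · refine le_trans ((abs_sub _ _).trans ?_) (le_max_right _ _)
      rw [abs_mul, abs_one]
      have := mul_le_mul_of_nonneg_left hr' (abs_nonneg c)
      linarith
  · rw [sub_zero]
    exact mul_le_mul_of_nonneg_left h1 (le_max_right _ _)

lemma LocBdd.intervalIntegrable (hs : LocBdd src)
    (hm : Measurable fun p : ℝ × ℝ => src p.1 p.2) (t x c p q : ℝ) :
    IntervalIntegrable (fun r => src (t + r) (x - c * r)) volume p q := by
  obtain ⟨B, hB⟩ := hs (max (|t| + max |p| |q|) (|x| + |c| * max |p| |q|))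
  refine intervalIntegrable_of_bdd (B := B)
    (hm.comp (by fun_prop : Measurable fun r : ℝ => (t + r, x - c * r))) fun r hr => ?_
  have hr' : |r| ≤ max |p| |q| := by
    rcases mem_uIcc.1 hr with h | h
    · exact abs_le_max_abs_abs h.1 h.2
    · rw [max_comm]; exact abs_le_max_abs_abs h.1 h.2
  refine hB _ _ ?_ ?_
  · exact le_trans ((abs_add_le _ _).trans (by linarith)) (le_max_left _ _)
  · refine le_trans ((abs_sub _ _).trans ?_) (le_max_right _ _)
    rw [abs_mul]
    have := mul_le_mul_of_nonneg_left hr' (abs_nonneg c)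
    linarith

lemma leftSolve_pde (hc : c ≠ 0) (hs : LocBdd src)
    (hm : Measurable fun p : ℝ × ℝ => src p.1 p.2) (t x s : ℝ) :
    leftSolve c src b (t + s) (x - c * s) = leftSolve c src b t x +
      ∫ r in (0 : ℝ)..s, src (t + r) (x - c * r) := by
  unfold leftSolve
  set p := (1 - x) / c with hp
  have e1 : (1 - (x - c * s)) / c = p + s := by rw [hp]; field_simp; ring
  have hx : x = 1 - c * p := by rw [hp]; field_simp; ring
  have e3 : ∫ r in (0 : ℝ)..s, src (t + r) (x - c * r)
      = ∫ r in p..p + s, src (t - p + r) (1 - c * r) := by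
    have := intervalIntegral.integral_comp_add_left (a := 0) (b := s)
      (fun r => src (t - p + r) (1 - c * r)) p
    rw [add_zero] at this
    rw [← this]
    refine intervalIntegral.integral_congr fun r _ => ?_
    rw [show 1 - c * (p + r) = x - c * r by rw [hx]; ring,
      show t - p + (p + r) = t + r by ring]
  rw [e1, show t + s - (p + s) = t - p by ring, e3, add_assoc,
    intervalIntegral.integral_add_adjacent_intervals]
  · exact hs.intervalIntegrable hm _ _ _ _ _
  · exact hs.intervalIntegrable hm _ _ _ _ _

lemma leftSolve_eq_zero_of_le (hc : 0 < c) {T : ℝ} (hs : ∀ t ≤ T, ∀ x, src t x = 0)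
    (hb : ∀ t ≤ T, b t = 0) {t x : ℝ} (hx : x ≤ 1) (ht : t ≤ T) : leftSolve c src b t x = 0 := by
  have hp : 0 ≤ (1 - x) / c := div_nonneg (by linarith) hc.le
  rw [leftSolve, hb _ (by linarith), zero_add]
  refine (intervalIntegral.integral_congr fun r hr => ?_).trans intervalIntegral.integral_zero
  rw [uIcc_of_le hp] at hr
  exact hs _ (by linarith [hr.2]) _

end LeftSolve

lemma abs_mulVec_le {ι ρ : Type*} [Fintype ι] {A : Matrix ρ ι ℝ} {k : ρ} {v : ι → ℝ} {B C : ℝ}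
    (hA : ∀ l, |A k l| ≤ B) (hv : ∀ l, |v l| ≤ C) :
    |A.mulVec v k| ≤ Fintype.card ι * (B * C) := by
  rw [← Real.norm_eq_abs]
  refine (norm_sum_le_of_le (f := fun l => A k l * v l) (n := fun _ => B * C) Finset.univ
    fun l _ => ?_).trans (by simp)
  rw [norm_mul]
  exact mul_le_mul (hA l) (hv l) (abs_nonneg _) ((abs_nonneg _).trans (hA l))

lemma measurable_mulVec {α ι ρ : Type*} [MeasurableSpace α] [Fintype ι] {A : α → Matrix ρ ι ℝ}
    {k : ρ} {v : α → ι → ℝ} (hA : ∀ l, Measurable fun p => A p k l)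
    (hv : ∀ l, Measurable fun p => v p l) : Measurable fun p => (A p).mulVec (v p) k := by
  simp only [Matrix.mulVec, dotProduct]
  exact Finset.measurable_fun_sum _ fun l _ => (hA l).mul (hv l)

/-! ### Bounds for the coefficients of `β`, perturbation of the inlet, existence of the closed loop.
-/

namespace Chain.Kernels

variable {S : Chain} {i : ℕ} (κ : S.Kernels)

lemma toBlocks₂₂_mul_apply {ρ : Type*} (M : Matrix (Fin (S.m i)) ρ ℝ) (x : ℝ) (j : Fin (S.m i))
    (k : ρ) : ((κ.K i x 1).toBlocks₂₂ * Matrix.diagonal (S.mu i) * M) j k =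
      ∑ l, κ.K i x 1 (Sum.inr j) (Sum.inr l) * S.mu i l * M l k := by
  rw [Matrix.mul_apply]
  simp only [Matrix.mul_diagonal, Matrix.toBlocks₂₂, Matrix.of_apply]

lemma measurable_toBlocks₂₂_mul (hi : i < S.N) {ρ : Type*} (M : Matrix (Fin (S.m i)) ρ ℝ)
    (j : Fin (S.m i)) (k : ρ) :
    Measurable fun x => ((κ.K i x 1).toBlocks₂₂ * Matrix.diagonal (S.mu i) * M) j k := by
  simp only [toBlocks₂₂_mul_apply]
  exact Finset.measurable_fun_sum _ fun l _ =>
    (((κ.K_meas i hi _ _).comp (by fun_prop : Measurable fun x : ℝ => (x, (1 : ℝ)))).mul_const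
      _).mul_const _

lemma exists_bound_toBlocks₂₂_mul (hi : i < S.N) {ρ : Type*} [Finite ρ]
    (M : Matrix (Fin (S.m i)) ρ ℝ) :
    ∃ B, ∀ x ∈ Icc (0 : ℝ) 1, ∀ j k,
      |((κ.K i x 1).toBlocks₂₂ * Matrix.diagonal (S.mu i) * M) j k| ≤ B := by
  obtain ⟨BK, hBK⟩ := κ.K_bdd i hi
  obtain ⟨B, -, hB⟩ := exists_uniform_bound (ι := Fin (S.m i) × ρ)
    (P := fun p B => ∀ x ∈ Icc (0 : ℝ) 1,
      |((κ.K i x 1).toBlocks₂₂ * Matrix.diagonal (S.mu i) * M) p.1 p.2| ≤ B)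
    (fun p B B' h hP x hx => (hP x hx).trans h)
    (fun ⟨j, k⟩ => by
      refine ⟨∑ l, BK * |S.mu i l| * |M l k|, fun x hx => ?_⟩
      simp only [toBlocks₂₂_mul_apply]
      refine (Finset.abs_sum_le_sum_abs _ _).trans (Finset.sum_le_sum fun l _ => ?_)
      rw [abs_mul, abs_mul]
      have := hBK x 1 hx.1 hx.2 le_rfl (Sum.inr j) (Sum.inr l)
      gcongr)
  exact ⟨B, fun x hx j k => hB (j, k) x hx⟩

lemma measurable_Gbar (hi : i < S.N) (j : Fin (S.m i)) (k : Fin (S.n i)) :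
    Measurable fun x => κ.Gbar i x j k := by
  refine (κ.measurable_toBlocks₂₂_mul hi (S.R i) j k).sub ?_
  simp only [Matrix.mul_diagonal, Matrix.toBlocks₂₁, Matrix.of_apply]
  exact ((κ.K_meas i hi _ _).comp (by fun_prop : Measurable fun x : ℝ => (x, (1 : ℝ)))).mul_const _

lemma exists_bound_Gbar (hi : i < S.N) :
    ∃ B, ∀ x ∈ Icc (0 : ℝ) 1, ∀ j k, |κ.Gbar i x j k| ≤ B := by
  obtain ⟨BK, hBK⟩ := κ.K_bdd i hi
  obtain ⟨B, hB⟩ := κ.exists_bound_toBlocks₂₂_mul hi (S.R i)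
  obtain ⟨Bl, -, hBl⟩ := exists_uniform_bound (ι := Fin (S.n i))
    (P := fun k B => BK * |S.lam i k| ≤ B) (fun k B B' h hP => hP.trans h)
    (fun k => ⟨_, le_rfl⟩)
  refine ⟨B + Bl, fun x hx j k => (abs_sub _ _).trans (add_le_add (hB x hx j k) ?_)⟩
  simp only [Matrix.mul_diagonal, Matrix.toBlocks₂₁, Matrix.of_apply]
  rw [abs_mul]
  refine le_trans ?_ (hBl k)
  have := hBK x 1 hx.1 hx.2 le_rfl (Sum.inr j) (Sum.inl k)
  gcongr

variable {κ} {t₀ : ℝ} {U : ℝ → Fin (S.n i) → ℝ} {w : ℝ → Fin (S.m (i + 1)) → ℝ}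
  {z γ : ℝ → ℝ → S.Idx i → ℝ}

lemma IsTrajectory.measurable_uOut (h : κ.IsTrajectory i t₀ U w z γ) (hi : i + 1 < S.N)
    (k : Fin (S.n i)) : Measurable fun t => κ.uOut i w γ t k := by
  refine ((h.γ_meas (Sum.inl k)).comp (by fun_prop : Measurable fun t : ℝ => (t, (1 : ℝ)))).sub
    (measurable_intervalIntegral
      (f := fun q : ℝ × ℝ => (κ.F i 1 q.2).mulVec (w (q.1 - q.2)) k) ?_ measurable_const
      measurable_const)
  exact measurable_mulVec
    (fun l => (κ.F_meas i hi k l).comp (by fun_prop : Measurable fun q : ℝ × ℝ => ((1 : ℝ), q.2)))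
    (fun l => (h.w_meas l).comp (by fun_prop : Measurable fun q : ℝ × ℝ => q.1 - q.2))

/-- The memory term reads `w` at `t - y` with `y ≤ S.tr i`; starting after `S.tr i` keeps these
times nonnegative, where `w` is bounded. -/
lemma IsTrajectory.exists_bound_uOut (h : κ.IsTrajectory i t₀ U w z γ) (hi : i + 1 < S.N)
    (ht₀ : S.tr i ≤ t₀) (T : ℝ) : ∃ B, ∀ t ∈ Icc t₀ T, ∀ k, |κ.uOut i w γ t k| ≤ B := by
  obtain ⟨Bγ, hBγ⟩ := h.γ_bdd T
  obtain ⟨BF, hBF⟩ := κ.F_bdd i hi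
  obtain ⟨Bw, hBw⟩ := h.w_bdd T
  have htr := tr_pos (S := S) (i := i) (by omega)
  refine ⟨Bγ + Fintype.card (Fin (S.m (i + 1))) * (BF * Bw) * |S.tr i - 0|, fun t ht k => ?_⟩
  refine (abs_sub _ _).trans (add_le_add (hBγ t ht 1 ⟨zero_le_one, le_rfl⟩ _) ?_)
  rw [← Real.norm_eq_abs]
  refine intervalIntegral.norm_integral_le_of_norm_le_const fun y hy => ?_
  rw [uIoc_of_le htr.le] at hy
  refine abs_mulVec_le (fun l => hBF 1 y le_rfl hy.1.le (by linarith [hy.2]) k l)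
    (fun l => hBw (t - y) ⟨by linarith [hy.2, ht.1], by linarith [hy.1, ht.2]⟩ l)

/-- The response of a trajectory to an additive perturbation `b` of the boundary values `αᵢ(·,0)`
that starts at time `T`. -/
lemma IsTrajectory.exists_perturbation (h : κ.IsTrajectory i t₀ U w z γ) (hi : i + 1 < S.N)
    (ht₀ : S.tr i ≤ t₀) {T : ℝ} {b : ℝ → Fin (S.n i) → ℝ}
    (hbm : ∀ k, Measurable fun t => b t k) (hbb : ∀ R : ℝ, ∃ B : ℝ, ∀ t k, |t| ≤ R → |b t k| ≤ B)
    (hb0 : ∀ t ≤ T, b t = 0) :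
    ∃ z' γ' : ℝ → ℝ → S.Idx i → ℝ,
      (∀ t ≤ T, ∀ x ∈ Icc (0 : ℝ) 1, z' t x = z t x ∧ γ' t x = γ t x) ∧
      (∀ t j, γ' t 0 (Sum.inl j) = γ t 0 (Sum.inl j) + b t j) ∧
      ∀ U', (∀ t, t₀ < t → ∀ j, γ' t 0 (Sum.inl j) =
        (S.Q i).mulVec (fun k => z' t 0 (Sum.inr k)) j + U' (t - S.delay i) j
        + (∫ y in (0 : ℝ)..1, (κ.K i 0 y).mulVec (z' t y) (Sum.inl j))
        - ∫ y in (0 : ℝ)..S.memory i, (κ.QF i y).mulVec (fun k => z' (t - y) 0 (Sum.inr k)) j) →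
        κ.IsTrajectory i t₀ U' w z' γ' := by
  have hi' : i < S.N := by omega
  have htr := tr_pos (S := S) (i := i) hi'
  obtain ⟨BG, hBG⟩ := κ.exists_bound_clampG hi'
  obtain ⟨Bb, hBb⟩ := κ.exists_bound_Gbar hi'
  obtain ⟨Bf, hBf⟩ := κ.exists_bound_toBlocks₂₂_mul hi' (S.Rup i)
  obtain ⟨BK, hBK⟩ := κ.K_bdd i hi'
  -- The changes of the trajectory are `a` in `α`, with outlet trace `A`, `δ` in `β`, and `e` in
  -- `(u, v)`. All vanish on `[0,1]` up to time `T` since `b` does.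
  set a : Fin (S.n i) → ℝ → ℝ → ℝ := triSolve (S.lam i) (κ.clampG i) 0 b with ha
  have ham : ∀ k, Measurable fun p : ℝ × ℝ => a k p.1 p.2 :=
    measurable_triSolve (κ.measurable_clampG hi') hbm
  have hab : ∀ k, LocBdd (a k) := locBdd_triSolve hBG hbb
  have ha0 : ∀ k t x, 0 ≤ x → t ≤ T → a k t x = 0 := fun k t x hx ht =>
    triSolve_eq_zero_of_le (S.lam_pos i hi') hb0 k hx ht
  set A : ℝ → Fin (S.n i) → ℝ := fun t k => a k t 1 with hA
  have hAm : ∀ k, Measurable fun t => A t k := fun k =>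
    (ham k).comp (by fun_prop : Measurable fun t : ℝ => (t, (1 : ℝ)))
  have hAb : ∀ R : ℝ, ∃ B : ℝ, 0 ≤ B ∧ ∀ k t, |t| ≤ R → |A t k| ≤ B := fun R =>
    exists_uniform_bound (P := fun k B => ∀ t, |t| ≤ R → |A t k| ≤ B)
      (fun k B B' h hP t ht => (hP t ht).trans h) (fun k => by
        obtain ⟨B, hB⟩ := hab k (max R 1)
        exact ⟨B, fun t ht => hB t 1 (ht.trans (le_max_left _ _)) (by simp)⟩)
  have hA0 : ∀ t ≤ T, A t = 0 := fun t ht => funext fun k => ha0 k t 1 zero_le_one ht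
  set src : Fin (S.m i) → ℝ → ℝ → ℝ := fun j t x => (κ.Gbar i (clamp x)).mulVec (A t) j with hsrc
  have hsm : ∀ j, Measurable fun p : ℝ × ℝ => src j p.1 p.2 := fun j =>
    measurable_mulVec
      (fun l => (κ.measurable_Gbar hi' j l).comp (continuous_clamp.measurable.comp measurable_snd))
      (fun l => (hAm l).comp measurable_fst)
  have hsb : ∀ j, LocBdd (src j) := fun j R => by
    obtain ⟨B, -, hB⟩ := hAb R
    exact ⟨_, fun t x ht _ => abs_mulVec_le (fun l => hBb _ (clamp_mem x) j l) fun l => hB l t ht⟩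
  set δ : Fin (S.m i) → ℝ → ℝ → ℝ := fun j =>
    leftSolve (S.mu i j) (src j) (fun t => (S.R i).mulVec (A t) j) with hδ
  have hRm : ∀ j, Measurable fun t => (S.R i).mulVec (A t) j := fun j =>
    measurable_mulVec (fun l => measurable_const) hAm
  have hδm : ∀ j, Measurable fun p : ℝ × ℝ => δ j p.1 p.2 := fun j =>
    measurable_leftSolve (hsm j) (hRm j)
  have hδb : ∀ j, LocBdd (δ j) := fun j => locBdd_leftSolve (hsb j) fun R => by
    obtain ⟨B, -, hB⟩ := hAb R
    obtain ⟨BR, -, hBR⟩ := exists_uniform_bound (P := fun l B => |S.R i j l| ≤ B)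
      (fun l B B' h hP => hP.trans h) (fun l => ⟨_, le_rfl⟩)
    exact ⟨_, fun t ht => abs_mulVec_le hBR fun l => hB l t ht⟩
  have hδ0 : ∀ j t x, x ≤ 1 → t ≤ T → δ j t x = 0 := fun j t x hx ht =>
    leftSolve_eq_zero_of_le (S.mu_pos i hi' j)
      (fun t ht x => by simp only [hsrc, hA0 t ht, Matrix.mulVec_zero, Pi.zero_apply])
      (fun t ht => by simp only [hA0 t ht, Matrix.mulVec_zero, Pi.zero_apply]) hx ht
  set g : ℝ → ℝ → S.Idx i → ℝ := fun t x => Sum.elim (fun k => a k t x) (fun j => δ j t x) with hg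
  have hgm : ∀ c, Measurable fun p : ℝ × ℝ => g p.1 p.2 c := by
    rintro (k | j)
    · exact ham k
    · exact hδm j
  have hgR : ∀ R : ℝ, ∃ B : ℝ, 0 ≤ B ∧ ∀ c t, |t| ≤ R → ∀ x ∈ Icc (0 : ℝ) 1, |g t x c| ≤ B :=
    fun R => exists_uniform_bound
      (P := fun c B => ∀ t, |t| ≤ R → ∀ x ∈ Icc (0 : ℝ) 1, |g t x c| ≤ B)
      (fun k B B' h hP t ht x hx => (hP t ht x hx).trans h) (by
        rintro (k | j)
        · obtain ⟨B, hB⟩ := hab k (max R 1)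
          exact ⟨B, fun t ht x hx => hB t x (ht.trans (le_max_left _ _))
            ((abs_le.2 ⟨by linarith [hx.1], hx.2⟩).trans (le_max_right _ _))⟩
        · obtain ⟨B, hB⟩ := hδb j (max R 1)
          exact ⟨B, fun t ht x hx => hB t x (ht.trans (le_max_left _ _))
            ((abs_le.2 ⟨by linarith [hx.1], hx.2⟩).trans (le_max_right _ _))⟩)
  have hg0 : ∀ t ≤ T, ∀ x ∈ Icc (0 : ℝ) 1, ∀ c, g t x c = 0 := by
    rintro t ht x hx (k | j)
    · exact ha0 k t x hx.1 ht
    · exact hδ0 j t x hx.2 ht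
  -- The terms with `F` and `w` cancel in the difference of two transforms, so only the Volterra
  -- part with kernel `K` has to be inverted.
  obtain ⟨e, C, hem, heb, he⟩ := exists_volterra_solution (κ.K_meas i hi') hBK hgm fun t => by
    obtain ⟨B, -, hB⟩ := hgR |t|
    exact ⟨B, fun x hx c => hB c t le_rfl x hx⟩
  -- The slicewise bound with `M = 0` forces the solution to vanish wherever the data do.
  have he0 : ∀ t ≤ T, ∀ x ∈ Icc (0 : ℝ) 1, e t x = 0 := fun t ht x hx => funext fun c => by
    have := heb t 0 le_rfl (fun x hx c => by rw [hg0 t ht x hx c, abs_zero]) x hx c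
    rw [mul_zero] at this
    exact abs_nonpos_iff.1 this
  have heR : ∀ R : ℝ, ∃ B, ∀ t, |t| ≤ R → ∀ x ∈ Icc (0 : ℝ) 1, ∀ c, |e t x c| ≤ B := fun R => by
    obtain ⟨B, hB0, hB⟩ := hgR R
    exact ⟨C * B, fun t ht x hx c => heb t B hB0 (fun x hx c => hB c t ht x hx) x hx c⟩
  have hKint : ∀ (f : ℝ → S.Idx i → ℝ) (B : ℝ), (∀ c, Measurable fun y => f y c) →
      (∀ y ∈ Icc (0 : ℝ) 1, ∀ c, |f y c| ≤ B) → ∀ x ∈ Icc (0 : ℝ) 1, ∀ c,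
      IntervalIntegrable (fun y => (κ.K i x y).mulVec (f y) c) volume x 1 := by
    intro f B hfm hfb x hx c
    refine intervalIntegrable_of_bdd (B := Fintype.card (S.Idx i) * (BK * B)) (measurable_mulVec
      (fun l => (κ.K_meas i hi' c l).comp (by fun_prop : Measurable fun y : ℝ => (x, y))) hfm)
      fun y hy => ?_
    rw [uIcc_of_le hx.2] at hy
    exact abs_mulVec_le (fun l => hBK x y hx.1 hy.1 hy.2 c l)
      (hfb y ⟨hx.1.trans hy.1, hy.2⟩)
  have hsplit : ∀ t, t₀ ≤ t → ∀ x ∈ Icc (0 : ℝ) 1, ∀ c,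
      (∫ y in x..1, (κ.K i x y).mulVec (z t y + e t y) c) =
      (∫ y in x..1, (κ.K i x y).mulVec (z t y) c) +
        ∫ y in x..1, (κ.K i x y).mulVec (e t y) c := by
    intro t ht x hx c
    obtain ⟨Bz, hBz⟩ := h.z_bdd t
    obtain ⟨Be, hBe⟩ := heR |t|
    rw [← intervalIntegral.integral_add]
    · simp only [Matrix.mulVec_add, Pi.add_apply]
    · exact hKint _ Bz (fun c => (h.z_meas c).comp (by fun_prop : Measurable fun y : ℝ => (t, y)))
        (fun y hy c => hBz t ⟨by linarith, le_rfl⟩ y hy c) x hx c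
    · exact hKint _ Be (fun c => (hem c).comp (by fun_prop : Measurable fun y : ℝ => (t, y)))
        (fun y hy c => hBe t le_rfl y hy c) x hx c
  have huOut : ∀ t, κ.uOut i w (fun t x => γ t x + g t x) t = κ.uOut i w γ t + A t := by
    intro t
    funext k
    simp only [uOut, Pi.add_apply, hg, Sum.elim_inl, hA]
    ring
  refine ⟨fun t x => z t x + e t x, fun t x => γ t x + g t x, fun t ht x hx => ⟨?_, ?_⟩,
    fun t j => ?_, fun U' hU' => ?_⟩
  · dsimp only
    rw [he0 t ht x hx, add_zero]
  · dsimp only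
    rw [show g t x = 0 from funext (hg0 t ht x hx), add_zero]
  · simp only [Pi.add_apply, hg, Sum.elim_inl, ha, triSolve_anchor]
  refine
    { z_meas := fun c => (h.z_meas c).add (hem c)
      γ_meas := fun c => (h.γ_meas c).add (hgm c)
      w_meas := h.w_meas
      z_bdd := fun T' => ?_
      γ_bdd := fun T' => ?_
      w_bdd := h.w_bdd
      transform_α := fun t ht x hx j => ?_
      transform_β := fun t ht x hx j => ?_
      pde_α := fun j t x s ht hx hs hxs => ?_
      pde_β := fun j t x s ht hx hs hxs => ?_
      bc_α := hU'
      bc_β := fun t ht j => ?_ }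
  · obtain ⟨Bz, hBz⟩ := h.z_bdd T'
    obtain ⟨Be, hBe⟩ := heR |T'|
    exact ⟨Bz + Be, fun t ht x hx c => (abs_add_le _ _).trans (add_le_add (hBz t ht x hx c)
      (hBe t (abs_le_abs_of_nonneg ht.1 ht.2) x hx c))⟩
  · obtain ⟨Bz, hBz⟩ := h.γ_bdd T'
    obtain ⟨Be, -, hBe⟩ := hgR |T'|
    exact ⟨Bz + Be, fun t ht x hx c => (abs_add_le _ _).trans (add_le_add (hBz t ht x hx c)
      (hBe c t (abs_le_abs_of_nonneg (by linarith [ht.1]) ht.2) x hx))⟩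
  · rw [hsplit t ht x hx, Pi.add_apply, Pi.add_apply, h.transform_α t ht x hx j,
      he t x hx (Sum.inl j)]
    ring
  · rw [hsplit t ht x hx, Pi.add_apply, Pi.add_apply, h.transform_β t ht x hx j,
      he t x hx (Sum.inr j)]
    ring
  · have hj := S.lam_pos i hi' j
    have hmem : ∀ r ∈ uIcc 0 s, x + S.lam i j * r ∈ Icc (0 : ℝ) 1 := fun r hr => by
      rw [uIcc_of_le hs] at hr
      exact ⟨by nlinarith [hr.1], by nlinarith [hr.2]⟩
    have e1 := h.pde_clampG hi' j ht hx hs hxs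
    have e2 := triSolve_pde (x₀ := 0) (κ.measurable_clampG hi') hBG κ.clampG_of_not_lt hbm hbb
      hj.ne' t x s
    rw [← ha] at e2
    have e3 : ∫ r in (0 : ℝ)..s, (S.G i (κ.K i) (x + S.lam i j * r)).mulVec
        (fun k => (γ (t + r) (x + S.lam i j * r) + g (t + r) (x + S.lam i j * r)) (Sum.inl k)) j =
        (∫ r in (0 : ℝ)..s, (κ.clampG i (x + S.lam i j * r)).mulVec
          (fun k => γ (t + r) (x + S.lam i j * r) (Sum.inl k)) j) +
        ∫ r in (0 : ℝ)..s, (κ.clampG i (x + S.lam i j * r)).mulVec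
          (fun k => a k (t + r) (x + S.lam i j * r)) j := by
      obtain ⟨Bγ, hBγ⟩ := h.γ_bdd (t + s)
      rw [← intervalIntegral.integral_add]
      · refine intervalIntegral.integral_congr fun r hr => ?_
        rw [← κ.clampG_eq (hmem r hr), ← Pi.add_apply (f := Matrix.mulVec _ _),
          ← Matrix.mulVec_add]
        rfl
      · refine mulVec_intervalIntegrable (κ.measurable_clampG hi') hBG (B := Bγ)
          (fun l => (h.γ_meas _).comp
            (by fun_prop : Measurable fun r : ℝ => (t + r, x + S.lam i j * r)))
          (fun r hr l => hBγ _ ?_ _ (hmem r hr) _) _ _ _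
        rw [uIcc_of_le hs] at hr
        exact ⟨by linarith [hr.1], by linarith [hr.2]⟩
      · exact triSolve_intervalIntegrable (κ.measurable_clampG hi') hBG hbm hbb j t x 0 s _
    rw [e3, Pi.add_apply, Pi.add_apply, e1]
    change _ + a j (t + s) (x + S.lam i j * s) = _ + a j t x + _
    rw [e2]
    ring
  · have hj := S.mu_pos i hi' j
    have hmem : ∀ r ∈ uIcc 0 s, x - S.mu i j * r ∈ Icc (0 : ℝ) 1 := fun r hr => by
      rw [uIcc_of_le hs] at hr
      exact ⟨by nlinarith [hr.2], by nlinarith [hr.1]⟩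
    have e1 := h.pde_β j t x s ht hx hs hxs
    have e2 : δ j (t + s) (x - S.mu i j * s) = δ j t x +
        ∫ r in (0 : ℝ)..s, src j (t + r) (x - S.mu i j * r) :=
      leftSolve_pde hj.ne' (hsb j) (hsm j) t x s
    have e3 : ∫ r in (0 : ℝ)..s, ((κ.Gbar i (x - S.mu i j * r)).mulVec
        (κ.uOut i w (fun t x => γ t x + g t x) (t + r)) j
        + (κ.fbar i (x - S.mu i j * r)).mulVec (w (t + r)) j) =
        (∫ r in (0 : ℝ)..s, ((κ.Gbar i (x - S.mu i j * r)).mulVec (κ.uOut i w γ (t + r)) j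
          + (κ.fbar i (x - S.mu i j * r)).mulVec (w (t + r)) j)) +
        ∫ r in (0 : ℝ)..s, src j (t + r) (x - S.mu i j * r) := by
      obtain ⟨Bu, hBu⟩ := h.exists_bound_uOut hi ht₀ (t + s)
      obtain ⟨Bw, hBw⟩ := h.w_bdd (t + s)
      rw [← intervalIntegral.integral_add]
      · refine intervalIntegral.integral_congr fun r hr => ?_
        simp only [huOut, hsrc, clamp_eq (hmem r hr), Matrix.mulVec_add, Pi.add_apply]
        ring
      · refine intervalIntegrable_of_bdd (B := Fintype.card (Fin (S.n i)) * (Bb * Bu) +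
          Fintype.card (Fin (S.m (i + 1))) * (Bf * Bw)) (Measurable.add ?_ ?_) fun r hr => ?_
        · exact measurable_mulVec (fun l => (κ.measurable_Gbar hi' j l).comp (by fun_prop))
            (fun l => (h.measurable_uOut hi l).comp (by fun_prop))
        · exact measurable_mulVec
            (fun l => (κ.measurable_toBlocks₂₂_mul hi' (S.Rup i) j l).comp (by fun_prop))
            (fun l => (h.w_meas l).comp (by fun_prop))
        · have hr' := hr
          rw [uIcc_of_le hs] at hr'
          exact (abs_add_le _ _).trans (add_le_add
            (abs_mulVec_le (fun l => hBb _ (hmem r hr) j l)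
              (fun l => hBu _ ⟨by linarith [hr'.1], by linarith [hr'.2]⟩ l))
            (abs_mulVec_le (fun l => hBf _ (hmem r hr) j l)
              (fun l => hBw _ ⟨by linarith [hr'.1], by linarith [hr'.2]⟩ l)))
      · exact (hsb j).intervalIntegrable (hsm j) _ _ _ _ _
    rw [e3, Pi.add_apply, Pi.add_apply, e1]
    change _ + δ j (t + s) (x - S.mu i j * s) = _ + δ j t x + _
    rw [e2]
    ring
  · rw [huOut, Matrix.mulVec_add, Pi.add_apply, Pi.add_apply, h.bc_β t ht j]
    change _ + δ j t 1 = _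
    rw [show δ j t 1 = (S.R i).mulVec (A t) j from leftSolve_one t]
    ring

/-- From any trajectory, the law can be switched on. -/
lemma IsTrajectory.exists_closedLoop (h : κ.IsTrajectory i t₀ U w z γ) (hi : i + 1 < S.N)
    (hi' : i < S.N) (ht₀ : S.tr i ≤ t₀) {ζ : ℝ → Fin (S.n i) → ℝ}
    (hζ : ContinuousOn ζ (Ici 0)) :
    ∃ (U' : ℝ → Fin (S.n i) → ℝ) (z' γ' : ℝ → ℝ → S.Idx i → ℝ),
      κ.IsTrajectory i t₀ U' w z' γ' ∧
      (∀ t, t ≤ t₀ + S.memory i → U' t = U t) ∧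
      (∀ t, t ≤ t₀ + S.memory i + S.delay i → ∀ x ∈ Icc (0 : ℝ) 1,
        z' t x = z t x ∧ γ' t x = γ t x) ∧
      (κ.controlLaw hi').Drives (t₀ + S.memory i) ζ
        (fun t x => z' (t + S.delay i) x) (fun t x => γ' (t + S.delay i) x) U' := by
  have hm := memory_nonneg hi'
  have hd := delay_nonneg hi'
  have htr := tr_pos (S := S) (i := i) hi'
  obtain ⟨BG, hBG⟩ := κ.exists_bound_clampG hi'
  obtain ⟨d, hdζ, hdm, hdb⟩ := exists_extension_of_continuousOn hζ
  set T := t₀ + S.memory i + S.delay i with hT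
  -- The perturbation replaces the inlet value of `α` after `T` by the transported reference.
  set b : ℝ → Fin (S.n i) → ℝ := fun t j =>
    if T < t then triSolve (S.lam i) (κ.clampG i) 1 d j t 0 - γ t 0 (Sum.inl j) else 0 with hb
  have hbm : ∀ k, Measurable fun t => b t k := fun k =>
    Measurable.ite measurableSet_Ioi
      (((measurable_triSolve (κ.measurable_clampG hi') hdm k).comp
        (by fun_prop : Measurable fun t : ℝ => (t, (0 : ℝ)))).sub
        ((h.γ_meas (Sum.inl k)).comp (by fun_prop : Measurable fun t : ℝ => (t, (0 : ℝ)))))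
      measurable_const
  have hbb : ∀ R : ℝ, ∃ B : ℝ, ∀ t k, |t| ≤ R → |b t k| ≤ B := by
    intro R
    obtain ⟨B, hB0, hB⟩ := exists_uniform_bound (ι := Fin (S.n i))
      (P := fun k B => ∀ t, |t| ≤ R → |triSolve (S.lam i) (κ.clampG i) 1 d k t 0| ≤ B)
      (fun k B B' h hP t ht => (hP t ht).trans h) (fun k => by
        obtain ⟨B, hB⟩ := locBdd_triSolve (lam := S.lam i) (x₀ := 1) hBG hdb k R
        exact ⟨B, fun t ht => hB t 0 ht (by simpa using (abs_nonneg t).trans ht)⟩)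
    obtain ⟨Bγ, hBγ⟩ := h.γ_bdd R
    refine ⟨B + max Bγ 0, fun t k ht => ?_⟩
    simp only [hb]
    split_ifs with hTt
    · exact (abs_sub _ _).trans (add_le_add (hB k t ht)
        ((hBγ t ⟨by linarith, (le_abs_self t).trans ht⟩ 0 ⟨le_rfl, zero_le_one⟩ _).trans
          (le_max_left _ _)))
    · rw [abs_zero]; positivity
  have hb0 : ∀ t ≤ T, b t = 0 := fun t ht => funext fun k => if_neg (not_lt.2 ht)
  obtain ⟨z', γ', hzγ, hγ0, htraj⟩ := h.exists_perturbation hi ht₀ hbm hbb hb0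
  set Pz : ℝ → ℝ → S.Idx i → ℝ := fun t x => z' (t + S.delay i) x with hPz
  set Pγ : ℝ → ℝ → S.Idx i → ℝ := fun t x => γ' (t + S.delay i) x with hPγ
  -- The new states are already fixed independently of `U'`, so the law can be evaluated on their
  -- future values without circularity.
  set U' : ℝ → Fin (S.n i) → ℝ := fun t => if t ≤ t₀ + S.memory i then U t else
    (κ.controlLaw hi').ff ζ t + (κ.controlLaw hi').fb Pz Pγ t with hU'
  refine ⟨U', z', γ', htraj U' fun t ht j => ?_, fun t ht => if_pos ht, hzγ,
    fun t ht => if_neg (not_le.2 ht)⟩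
  -- Up to `T` states and delayed input are unchanged and the old inlet condition persists. After
  -- `T` the law cancels everything but the transported reference.
  rcases le_or_gt t T with htT | htT
  · have e1 : ∫ y in (0 : ℝ)..1, (κ.K i 0 y).mulVec (z' t y) (Sum.inl j) =
        ∫ y in (0 : ℝ)..1, (κ.K i 0 y).mulVec (z t y) (Sum.inl j) := by
      refine intervalIntegral.integral_congr fun y hy => ?_
      rw [uIcc_of_le zero_le_one] at hy
      simp only [(hzγ t htT y hy).1]
    have e2 : ∫ y in (0 : ℝ)..S.memory i, (κ.QF i y).mulVec (fun k => z' (t - y) 0 (Sum.inr k)) j =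
        ∫ y in (0 : ℝ)..S.memory i, (κ.QF i y).mulVec (fun k => z (t - y) 0 (Sum.inr k)) j := by
      refine intervalIntegral.integral_congr fun y hy => ?_
      rw [uIcc_of_le hm] at hy
      simp only [(hzγ (t - y) (by linarith [hy.1]) 0 ⟨le_rfl, zero_le_one⟩).1]
    obtain ⟨h1, h2⟩ := hzγ t htT 0 ⟨le_rfl, zero_le_one⟩
    rw [e1, e2, h1, h2, show U' (t - S.delay i) = U (t - S.delay i) from
      if_pos (by linarith), h.bc_α t ht j]
  · have e1 : U' (t - S.delay i) = (κ.controlLaw hi').ff ζ (t - S.delay i) +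
        (κ.controlLaw hi').fb Pz Pγ (t - S.delay i) := if_neg (by linarith)
    have e2 : triSolve (S.lam i) (κ.clampG i) 1 d j t 0 =
        triSolve (S.lam i) (κ.clampG i) 1 ζ j t 0 :=
      triSolve_one_congr (S.lam_pos i hi') (inv_lam_le_tr hi') (t₀ := t) (t₁ := t + S.tr i)
        (fun s hs => hdζ s (by linarith [hs.1])) j zero_le_one le_rfl (by simp)
    have e3 : b t j = triSolve (S.lam i) (κ.clampG i) 1 d j t 0 - γ t 0 (Sum.inl j) := if_pos htT
    rw [hγ0, e3, e2, e1]
    simp only [Pi.add_apply, controlLaw, hPz, sub_add_cancel,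
      show ∀ y, t - S.delay i - y + S.delay i = t - y from fun y => by ring]
    ring

end Chain.Kernels

/-! ### `L²` growth over a bounded time. -/

/-- The integral of `f²` over `[0,1]`. -/
def sqInt (f : ℝ → ℝ) : ENNReal := ∫⁻ x in Icc (0 : ℝ) 1, ENNReal.ofReal (f x ^ 2)

/-- Reflection brings the leftward transport of `β` to the rightward form covered by the transport
estimates. -/
lemma sqInt_reflect {f : ℝ → ℝ} : sqInt (fun x => f (1 - x)) = sqInt f := by
  unfold sqInt
  rw [← lintegral_indicator measurableSet_Icc, ← lintegral_indicator measurableSet_Icc,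
    ← lintegral_sub_left_eq_self _ (1 : ℝ)]
  refine lintegral_congr fun x => ?_
  by_cases h : x ∈ Icc (0 : ℝ) 1
  · rw [indicator_of_mem h, indicator_of_mem (by exact ⟨by linarith [h.2], by linarith [h.1]⟩)]
    simp
  · rw [indicator_of_notMem h, indicator_of_notMem]
    exact fun h' => h ⟨by linarith [h'.2], by linarith [h'.1]⟩

section Triangular

variable {n : ℕ}

/-- Measurable solution, from time `T` on, of `∂ₜ a + Λ ∂ₓ a = G(x) a`, `a(t,0) = 0`. -/
structure IsHomogeneousSolution (lam : Fin n → ℝ) (G : ℝ → Matrix (Fin n) (Fin n) ℝ) (T : ℝ)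
    (a : Fin n → ℝ → ℝ → ℝ) : Prop where
  meas : ∀ k, Measurable fun p : ℝ × ℝ => a k p.1 p.2
  pde : ∀ k t x s, T ≤ t → 0 ≤ x → 0 ≤ s → x + lam k * s ≤ 1 →
    a k (t + s) (x + lam k * s) = a k t x + ∫ r in (0 : ℝ)..s,
      (G (x + lam k * r)).mulVec (fun l => a l (t + r) (x + lam k * r)) k
  inlet : ∀ k t, T < t → a k t 0 = 0

variable {lam : Fin n → ℝ} {G : ℝ → Matrix (Fin n) (Fin n) ℝ} {BG : ℝ}

/-- Row `k` of `G` involves only components `l > k`. Bounds for these suffice, which makes downward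
induction on `k` possible. -/
lemma lintegral_source_le (hG : ∀ x k l, ¬ k < l → G x k l = 0) (hGb : ∀ x k l, |G x k l| ≤ BG)
    {a : Fin n → ℝ → ℝ → ℝ} (ha : ∀ k, Measurable fun p : ℝ × ℝ => a k p.1 p.2) {T t₁ L : ℝ}
    (hL : t₁ ≤ T + L) (k : Fin n) {C : Fin n → ENNReal} {N : ENNReal}
    (hC : ∀ l, k < l → ∀ s ∈ Icc T t₁, sqInt (a l s) ≤ C l * N) :
    ∫⁻ s in Icc T t₁, ∫⁻ x in Icc (0 : ℝ) 1,
      ENNReal.ofReal ((G x).mulVec (fun l => a l s x) k ^ 2) ≤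
      ENNReal.ofReal L * (ENNReal.ofReal (n * BG ^ 2) * ∑ l, C l) * N := by
  have key : ∀ s ∈ Icc T t₁, ∫⁻ x in Icc (0 : ℝ) 1,
      ENNReal.ofReal ((G x).mulVec (fun l => a l s x) k ^ 2) ≤
      ENNReal.ofReal (n * BG ^ 2) * (∑ l, C l) * N := by
    intro s hs
    calc ∫⁻ x in Icc (0 : ℝ) 1, ENNReal.ofReal ((G x).mulVec (fun l => a l s x) k ^ 2)
        ≤ ∫⁻ x in Icc (0 : ℝ) 1, ENNReal.ofReal (n * BG ^ 2) *
            ∑ l, ENNReal.ofReal ((if k < l then a l s x else 0) ^ 2) := by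
          refine lintegral_mono fun x => ?_
          have e : (G x).mulVec (fun l => a l s x) k =
              (G x).mulVec (fun l => if k < l then a l s x else 0) k := by
            simp only [Matrix.mulVec, dotProduct]
            refine Finset.sum_congr rfl fun l _ => ?_
            split_ifs with h
            · rfl
            · rw [hG x k l h, zero_mul, zero_mul]
          rw [e]
          have := ofReal_sq_mulVec_le (G x) k (hGb x k) (fun l => if k < l then a l s x else 0)
          rwa [Fintype.card_fin] at this
      _ = ENNReal.ofReal (n * BG ^ 2) *
            ∑ l, ∫⁻ x in Icc (0 : ℝ) 1, ENNReal.ofReal ((if k < l then a l s x else 0) ^ 2) := by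
          have hm : ∀ l, Measurable fun x =>
              ENNReal.ofReal ((if k < l then a l s x else 0) ^ 2) := fun l => by
            by_cases h : k < l
            · simp only [h, if_true]
              exact (((ha l).comp (by fun_prop : Measurable fun x : ℝ => (s, x))).pow_const
                2).ennreal_ofReal
            · simp only [h, if_false]
              exact measurable_const
          rw [lintegral_const_mul _ (Finset.measurable_fun_sum _ fun l _ => hm l),
            lintegral_finsetSum _ fun l _ => hm l]
      _ ≤ ENNReal.ofReal (n * BG ^ 2) * ∑ l, C l * N := by
          gcongr with l
          by_cases h : k < l
          · simp only [h, if_true]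
            exact hC l h s hs
          · simp [h]
      _ = ENNReal.ofReal (n * BG ^ 2) * (∑ l, C l) * N := by rw [← Finset.sum_mul, mul_assoc]
  calc _ ≤ ∫⁻ _ in Icc T t₁, ENNReal.ofReal (n * BG ^ 2) * (∑ l, C l) * N :=
        setLIntegral_mono' measurableSet_Icc key
    _ = ENNReal.ofReal (n * BG ^ 2) * (∑ l, C l) * N * ENNReal.ofReal (t₁ - T) := by
        rw [setLIntegral_const, Real.volume_Icc]
    _ ≤ ENNReal.ofReal (n * BG ^ 2) * (∑ l, C l) * N * ENNReal.ofReal L := by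
        gcongr; linarith
    _ = _ := by ring

lemma IsHomogeneousSolution.source_meas {T : ℝ} {a : Fin n → ℝ → ℝ → ℝ}
    (h : IsHomogeneousSolution lam G T a) (hGm : ∀ k l, Measurable fun x => G x k l) (k : Fin n) :
    Measurable fun p : ℝ × ℝ => (G p.2).mulVec (fun l => a l p.1 p.2) k :=
  measurable_mulVec (fun l => (hGm k l).comp measurable_snd) h.meas

/-- Over a bounded time, the `L²` norm of a homogeneous solution is controlled by the initial
one. -/
lemma exists_sqInt_bound (hlam : ∀ k, 0 < lam k) (hGm : ∀ k l, Measurable fun x => G x k l)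
    (hG : ∀ x k l, ¬ k < l → G x k l = 0) (hGb : ∀ x k l, |G x k l| ≤ BG) (L : ℝ) (k : Fin n) :
    ∃ C : ENNReal, C ≠ ⊤ ∧ ∀ (a : Fin n → ℝ → ℝ → ℝ) (T : ℝ), IsHomogeneousSolution lam G T a →
      ∀ t₁ ∈ Icc T (T + L), sqInt (a k t₁) ≤ C * ∑ l, sqInt (a l T) := by
  induction k using WellFoundedGT.induction with
  | _ k ih =>
    have ih' : ∀ l, ∃ C : ENNReal, C ≠ ⊤ ∧ (k < l → ∀ (a : Fin n → ℝ → ℝ → ℝ) (T : ℝ),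
        IsHomogeneousSolution lam G T a → ∀ t₁ ∈ Icc T (T + L),
          sqInt (a l t₁) ≤ C * ∑ l, sqInt (a l T)) := fun l => by
      by_cases h : k < l
      · obtain ⟨C, hC, hC'⟩ := ih l h
        exact ⟨C, hC, fun _ => hC'⟩
      · exact ⟨0, by simp, fun h' => absurd h' h⟩
    choose C hC hCb using ih'
    set M := ENNReal.ofReal L * (ENNReal.ofReal (n * BG ^ 2) * ∑ l, C l) with hM
    have hMf : M ≠ ⊤ := ENNReal.mul_ne_top ENNReal.ofReal_ne_top
      (ENNReal.mul_ne_top ENNReal.ofReal_ne_top (ENNReal.sum_ne_top.2 fun l _ => hC l))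
    -- The first 2 weighs the initial data, the inlet contributes nothing, and `M` bounds the source
    -- in terms of the components of larger index.
    refine ⟨2 + 2 * (ENNReal.ofReal L * M), by finiteness, fun a T h t₁ ht₁ => ?_⟩
    set N := ∑ l, sqInt (a l T) with hN
    have h1 := transport_lintegral_sq_le (f := a k)
      (g := fun t x => (G x).mulVec (fun l => a l t x) k) (b := fun _ => 0) (hlam k) (h.pde k)
      (h.inlet k) (h.source_meas hGm k)
      ((h.meas k).comp (by fun_prop : Measurable fun x : ℝ => (T, x))) measurable_const ht₁.1
    have h2 := lintegral_source_le hG hGb h.meas ht₁.2 k (C := C) (N := N)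
      fun l hl s hs => hCb l hl a T h s ⟨hs.1, hs.2.trans ht₁.2⟩
    have h3 : sqInt (a k T) ≤ N :=
      Finset.single_le_sum (f := fun l => sqInt (a l T)) (fun _ _ => zero_le) (Finset.mem_univ k)
    refine h1.trans ?_
    simp only [ne_eq, OfNat.ofNat_ne_zero, not_false_eq_true, zero_pow, ENNReal.ofReal_zero,
      lintegral_const, zero_mul, mul_zero, add_zero]
    rw [add_mul, mul_assoc, mul_assoc]
    gcongr
    · exact h3
    · linarith [ht₁.2]

/-- Over a bounded time, the outlet values of a homogeneous solution are controlled in `L²` by the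
initial state. -/
lemma exists_outlet_bound (hlam : ∀ k, 0 < lam k) (hGm : ∀ k l, Measurable fun x => G x k l)
    (hG : ∀ x k l, ¬ k < l → G x k l = 0) (hGb : ∀ x k l, |G x k l| ≤ BG) (L : ℝ) (k : Fin n) :
    ∃ C : ENNReal, C ≠ ⊤ ∧ ∀ (a : Fin n → ℝ → ℝ → ℝ) (T : ℝ), IsHomogeneousSolution lam G T a →
      ∀ t₁ ∈ Icc T (T + L), ∫⁻ s in Icc T t₁, ENNReal.ofReal (a k s 1 ^ 2) ≤
        C * ∑ l, sqInt (a l T) := by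
  choose C hC hCb using exists_sqInt_bound hlam hGm hG hGb L
  set M := ENNReal.ofReal L * (ENNReal.ofReal (n * BG ^ 2) * ∑ l, C l) with hM
  have hMf : M ≠ ⊤ := ENNReal.mul_ne_top ENNReal.ofReal_ne_top
    (ENNReal.mul_ne_top ENNReal.ofReal_ne_top (ENNReal.sum_ne_top.2 fun l _ => hC l))
  set c := ENNReal.ofReal (lam k)⁻¹ with hc
  refine ⟨2 * c + 2 * (ENNReal.ofReal L * (c * M)), by finiteness, fun a T h t₁ ht₁ => ?_⟩
  set N := ∑ l, sqInt (a l T) with hN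
  have h1 := transport_outlet_lintegral_sq_le (f := a k) (t₁ := t₁)
    (g := fun t x => (G x).mulVec (fun l => a l t x) k) (b := fun _ => 0) (hlam k) (h.pde k)
    (h.inlet k) (h.source_meas hGm k)
    ((h.meas k).comp (by fun_prop : Measurable fun x : ℝ => (T, x))) measurable_const
  have h2 := lintegral_source_le hG hGb h.meas ht₁.2 k (C := C) (N := N)
    fun l _ s hs => hCb l a T h s ⟨hs.1, hs.2.trans ht₁.2⟩
  have h3 : sqInt (a k T) ≤ N :=
    Finset.single_le_sum (f := fun l => sqInt (a l T)) (fun _ _ => zero_le) (Finset.mem_univ k)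
  refine h1.trans ?_
  simp only [ne_eq, OfNat.ofNat_ne_zero, not_false_eq_true, zero_pow, ENNReal.ofReal_zero,
    lintegral_const, zero_mul, add_zero]
  rw [add_mul, mul_assoc, mul_assoc, mul_assoc, mul_assoc]
  gcongr
  · exact h3
  · linarith [ht₁.2]

end Triangular

/-! ### Finite-time extinction and exponential decay. -/

namespace Chain.Kernels

variable {S : Chain} {i : ℕ} {κ : S.Kernels} {t₀ : ℝ} {U : ℝ → Fin (S.n i) → ℝ}
  {w : ℝ → Fin (S.m (i + 1)) → ℝ} {z γ : ℝ → ℝ → S.Idx i → ℝ}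

/-- From time `S.tr i` on, the memory term sees only nonnegative times, where the downstream signal
vanishes. -/
lemma uOut_eq (hi : i < S.N) (hw : ∀ t, 0 ≤ t → w t = 0) {t : ℝ} (ht : S.tr i ≤ t) :
    κ.uOut i w γ t = fun k => γ t 1 (Sum.inl k) := by
  funext k
  have : ∫ y in (0 : ℝ)..S.tr i, (κ.F i 1 y).mulVec (w (t - y)) k = 0 := by
    refine (intervalIntegral.integral_congr fun y hy => ?_).trans intervalIntegral.integral_zero
    rw [uIcc_of_le (tr_pos hi).le] at hy
    simp only [hw (t - y) (by linarith [hy.2]), Matrix.mulVec_zero, Pi.zero_apply]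
  rw [uOut, this, sub_zero]

lemma IsTrajectory.isHomogeneousSolution (h : κ.IsTrajectory i t₀ U w z γ) (hi : i < S.N) {T : ℝ}
    (hT : t₀ ≤ T) (h0 : ∀ t, T < t → ∀ j, γ t 0 (Sum.inl j) = 0) :
    IsHomogeneousSolution (S.lam i) (κ.clampG i) T fun k t x => γ t x (Sum.inl k) where
  meas _ := h.γ_meas _
  pde k _ _ _ ht hx hs hxs := h.pde_clampG hi k (hT.trans ht) hx hs hxs
  inlet k t ht := h0 t ht k

variable (κ) in
/-- Over a bounded time, with homogeneous boundary values of `α` and without downstream signal, the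
`L²` norm of a trajectory is controlled by the initial one. -/
lemma exists_trajectory_sqInt_bound (hi : i < S.N) (L : ℝ) :
    ∃ C : ENNReal, C ≠ ⊤ ∧ ∀ (t₀ T : ℝ) (U : ℝ → Fin (S.n i) → ℝ)
      (w : ℝ → Fin (S.m (i + 1)) → ℝ) (z γ : ℝ → ℝ → S.Idx i → ℝ),
      κ.IsTrajectory i t₀ U w z γ → S.tr i ≤ t₀ → t₀ ≤ T → (∀ t, 0 ≤ t → w t = 0) →
      (∀ t, T < t → ∀ j, γ t 0 (Sum.inl j) = 0) → ∀ t₁ ∈ Icc T (T + L),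
      ∑ c, sqInt (fun x => γ t₁ x c) ≤ C * ∑ c, sqInt (fun x => γ T x c) := by
  obtain ⟨BG, hBG⟩ := κ.exists_bound_clampG hi
  obtain ⟨Bb, hBb⟩ := κ.exists_bound_Gbar hi
  obtain ⟨BR, -, hBR⟩ := exists_uniform_bound (ι := Fin (S.m i) × Fin (S.n i))
    (P := fun p B => |S.R i p.1 p.2| ≤ B) (fun p B B' h hP => hP.trans h) (fun p => ⟨_, le_rfl⟩)
  choose Cα hCα hCαb using exists_sqInt_bound (S.lam_pos i hi) (κ.measurable_clampG hi)
    κ.clampG_of_not_lt hBG L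
  choose O hO hOb using exists_outlet_bound (S.lam_pos i hi) (κ.measurable_clampG hi)
    κ.clampG_of_not_lt hBG L
  set DR := ENNReal.ofReal (Fintype.card (Fin (S.n i)) * BR ^ 2) with hDR
  set DG := ENNReal.ofReal (Fintype.card (Fin (S.n i)) * Bb ^ 2) with hDG
  have hOf : ∑ l, O l ≠ ⊤ := ENNReal.sum_ne_top.2 fun l _ => hO l
  -- The boundary value `R α(·,1)` and the source `Ḡ α(·,1)` of `β` are both governed by the outlet
  -- trace; `DR` and `DG` are the corresponding matrix bounds.
  set Cβ : Fin (S.m i) → ENNReal := fun j =>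
    2 * (1 + ENNReal.ofReal (S.mu i j) * (DR * ∑ l, O l)) +
      2 * (ENNReal.ofReal L * (DG * ∑ l, O l)) with hCβ
  have hCβf : ∀ j, Cβ j ≠ ⊤ := fun j => by simp only [hCβ]; finiteness
  refine ⟨∑ k, Cα k + ∑ j, Cβ j, ENNReal.add_ne_top.2 ⟨ENNReal.sum_ne_top.2 fun k _ => hCα k,
    ENNReal.sum_ne_top.2 fun j _ => hCβf j⟩, ?_⟩
  intro t₀ T U w z γ h ht₀ hT hw h0 t₁ ht₁
  have htr := tr_pos (S := S) (i := i) hi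
  have hhom := h.isHomogeneousSolution hi hT h0
  set N := ∑ c, sqInt (fun x => γ T x c) with hN
  have hNα : ∑ l, sqInt (fun x => γ T x (Sum.inl l)) ≤ N := by
    rw [hN, Fintype.sum_sum_type]; exact le_self_add
  have hout : ∀ l, ∫⁻ s in Icc T t₁, ENNReal.ofReal (γ s 1 (Sum.inl l) ^ 2) ≤ O l * N :=
    fun l => (hOb l _ T hhom t₁ ht₁).trans (by gcongr)
  have hαm : ∀ l, Measurable fun s => γ s 1 (Sum.inl l) := fun l =>
    (h.γ_meas (Sum.inl l)).comp (by fun_prop : Measurable fun s : ℝ => (s, (1 : ℝ)))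
  have hout' : ∫⁻ s in Icc T t₁, ∑ l, ENNReal.ofReal (γ s 1 (Sum.inl l) ^ 2) ≤ (∑ l, O l) * N := by
    rw [lintegral_finsetSum _ fun l _ => ((hαm l).pow_const 2).ennreal_ofReal, Finset.sum_mul]
    exact Finset.sum_le_sum fun l _ => hout l
  have hβ : ∀ j, sqInt (fun x => γ t₁ x (Sum.inr j)) ≤ Cβ j * N := by
    intro j
    have hj := S.mu_pos i hi j
    set g : ℝ → ℝ → ℝ := fun t x =>
      (κ.Gbar i (clamp (1 - x))).mulVec (fun k => γ t 1 (Sum.inl k)) j with hg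
    set b : ℝ → ℝ := fun t => (S.R i).mulVec (fun k => γ t 1 (Sum.inl k)) j with hb
    have hgm : Measurable fun p : ℝ × ℝ => g p.1 p.2 := measurable_mulVec
      (fun l => (κ.measurable_Gbar hi j l).comp (continuous_clamp.measurable.comp (by fun_prop)))
      (fun l => (hαm l).comp measurable_fst)
    have hbm : Measurable b := measurable_mulVec (fun l => measurable_const) hαm
    have h1 := transport_lintegral_sq_le (f := fun t x => γ t (1 - x) (Sum.inr j)) (g := g)
      (b := b) hj (T := T) (t₁ := t₁)
      (fun t x s ht hx hs hxs => by
        have e := h.pde_β j t (1 - x) s (by linarith) (by linarith) hs (by linarith)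
        rw [show 1 - x - S.mu i j * s = 1 - (x + S.mu i j * s) by ring] at e
        rw [e]
        congr 1
        refine intervalIntegral.integral_congr fun r hr => ?_
        rw [uIcc_of_le hs] at hr
        simp only [hg]
        rw [hw _ (by linarith [hr.1]), uOut_eq hi hw (by linarith [hr.1]), Matrix.mulVec_zero,
          Pi.zero_apply, add_zero, clamp_eq ⟨by nlinarith [hr.2], by nlinarith [hr.1]⟩,
          show 1 - x - S.mu i j * r = 1 - (x + S.mu i j * r) by ring])
      (fun t ht => by
        have e := h.bc_β t (by linarith) j
        rw [hw _ (by linarith), uOut_eq hi hw (by linarith), Matrix.mulVec_zero, Pi.zero_apply,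
          add_zero] at e
        rw [sub_zero, e])
      hgm ((h.γ_meas (Sum.inr j)).comp (by fun_prop : Measurable fun x : ℝ => (T, 1 - x))) hbm
      ht₁.1
    have h2 : ∫⁻ s in Ioc T t₁, ENNReal.ofReal (b s ^ 2) ≤ DR * (∑ l, O l) * N := by
      calc ∫⁻ s in Ioc T t₁, ENNReal.ofReal (b s ^ 2)
          ≤ ∫⁻ s in Icc T t₁, ENNReal.ofReal (b s ^ 2) := lintegral_mono_set Ioc_subset_Icc_self
        _ ≤ ∫⁻ s in Icc T t₁, DR * ∑ l, ENNReal.ofReal (γ s 1 (Sum.inl l) ^ 2) :=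
            lintegral_mono fun s => ofReal_sq_mulVec_le _ j (fun l => hBR (j, l)) _
        _ ≤ DR * ((∑ l, O l) * N) := by
            rw [lintegral_const_mul _ (Finset.measurable_fun_sum _ fun l _ =>
              ((hαm l).pow_const 2).ennreal_ofReal)]
            gcongr
        _ = _ := by rw [mul_assoc]
    have h3 : ∫⁻ s in Icc T t₁, ∫⁻ x in Icc (0 : ℝ) 1, ENNReal.ofReal (g s x ^ 2) ≤
        DG * (∑ l, O l) * N := by
      calc ∫⁻ s in Icc T t₁, ∫⁻ x in Icc (0 : ℝ) 1, ENNReal.ofReal (g s x ^ 2)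
          ≤ ∫⁻ s in Icc T t₁, DG * ∑ l, ENNReal.ofReal (γ s 1 (Sum.inl l) ^ 2) := by
            refine lintegral_mono fun s => ?_
            refine (lintegral_mono fun x =>
              ofReal_sq_mulVec_le _ j (fun l => hBb _ (clamp_mem _) j l) _).trans ?_
            rw [setLIntegral_const, Real.volume_Icc]
            simp [hDG]
        _ ≤ DG * ((∑ l, O l) * N) := by
            rw [lintegral_const_mul _ (Finset.measurable_fun_sum _ fun l _ =>
              ((hαm l).pow_const 2).ennreal_ofReal)]
            gcongr
        _ = _ := by rw [mul_assoc]
    have h4 : sqInt (fun x => γ T (1 - x) (Sum.inr j)) ≤ N := by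
      rw [sqInt_reflect (f := fun x => γ T x (Sum.inr j))]
      exact Finset.single_le_sum (f := fun c => sqInt (fun x => γ T x c)) (fun _ _ => zero_le)
        (Finset.mem_univ (Sum.inr j))
    rw [← sqInt_reflect]
    refine h1.trans ?_
    calc _ ≤ 2 * (N + ENNReal.ofReal (S.mu i j) * (DR * (∑ l, O l) * N)) +
          2 * (ENNReal.ofReal L * (DG * (∑ l, O l) * N)) := by
          gcongr
          · exact h4
          · linarith [ht₁.2]
      _ = Cβ j * N := by simp only [hCβ]; ring
  rw [Fintype.sum_sum_type, add_mul, Finset.sum_mul, Finset.sum_mul]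
  refine add_le_add (Finset.sum_le_sum fun k _ => ?_) (Finset.sum_le_sum fun j _ => hβ j)
  exact (hCαb k _ T hhom t₁ ht₁).trans (by gcongr)

/-- Bounded Borel states have integrable squares, so the real integrals in `normL2` carry the same
information as the extended ones. -/
lemma IsTrajectory.ofReal_normL2_sq (h : κ.IsTrajectory i t₀ U w z γ) {t : ℝ} (ht : t₀ ≤ t) :
    ENNReal.ofReal (normL2 γ t ^ 2) = ∑ c, sqInt (fun x => γ t x c) := by
  have h0 : ∀ c, 0 ≤ ∫ x in (0 : ℝ)..1, γ t x c ^ 2 := fun c =>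
    intervalIntegral.integral_nonneg zero_le_one fun x _ => sq_nonneg _
  obtain ⟨B, hB⟩ := h.γ_bdd t
  rw [normL2, Real.sq_sqrt (Finset.sum_nonneg fun c _ => h0 c),
    ENNReal.ofReal_sum_of_nonneg fun c _ => h0 c]
  refine Finset.sum_congr rfl fun c _ => ?_
  have hint : IntervalIntegrable (fun x => γ t x c ^ 2) volume 0 1 := by
    refine intervalIntegrable_of_bdd (B := B ^ 2) (((h.γ_meas c).comp
      (by fun_prop : Measurable fun x : ℝ => (t, x))).pow_const 2) fun x hx => ?_
    rw [uIcc_of_le zero_le_one] at hx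
    rw [abs_pow]
    exact pow_le_pow_left₀ (abs_nonneg _) (hB t ⟨ht, le_rfl⟩ x hx c) 2
  rw [intervalIntegral.integral_of_le zero_le_one, sqInt, ofReal_integral_eq_lintegral_ofReal
    ((intervalIntegrable_iff_integrableOn_Ioc_of_le zero_le_one).1 hint)
    (Filter.Eventually.of_forall fun x => sq_nonneg _)]
  exact setLIntegral_congr Ioc_ae_eq_Icc

/-- Finite-time extinction, once `α` vanishes at `x = 0`. -/
lemma IsTrajectory.eq_zero (h : κ.IsTrajectory i t₀ U w z γ) (hi : i < S.N) (ht₀ : S.tr i ≤ t₀)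
    {T : ℝ} (hT : t₀ ≤ T) (hw : ∀ t, 0 ≤ t → w t = 0)
    (hα : ∀ t, ∀ x ∈ Icc (0 : ℝ) 1, T < t - x * S.tr i → ∀ k, γ t x (Sum.inl k) = 0)
    {t x : ℝ} (ht : T + S.tr i + S.tl i < t) (hx : x ∈ Icc (0 : ℝ) 1) : γ t x = 0 := by
  have htr := tr_pos (S := S) (i := i) hi
  have htl := tl_pos (S := S) (i := i) hi
  have h1 : ∀ s, T + S.tr i < s → κ.uOut i w γ s = 0 := fun s hs => by
    rw [uOut_eq hi hw (by linarith)]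
    exact funext fun k => hα s 1 ⟨zero_le_one, le_rfl⟩ (by linarith) k
  funext c
  rcases c with k | j
  · refine hα t x hx ?_ k
    have := mul_le_mul_of_nonneg_right hx.2 htr.le
    linarith
  · have hj := S.mu_pos i hi j
    set p := (1 - x) / S.mu i j with hp
    have hp0 : 0 ≤ p := div_nonneg (by linarith [hx.2]) hj.le
    have hpx : S.mu i j * p = 1 - x := by rw [hp]; field_simp
    have hpl : p ≤ S.tl i := by
      rw [hp, div_eq_mul_inv]
      have := inv_mu_le_tl hi j
      have := inv_nonneg.2 hj.le
      nlinarith [hx.1, hx.2]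
    -- The backward characteristic meets `x = 1` at `t - p > T + S.tr i`, when the outlet trace of
    -- `α` is already zero; boundary value and source then both vanish.
    have e := h.pde_β j (t - p) 1 p (by linarith) le_rfl hp0 (by linarith [hx.1])
    rw [sub_add_cancel, hpx, sub_sub_cancel] at e
    rw [e, h.bc_β (t - p) (by linarith) j, h1 _ (by linarith), hw _ (by linarith),
      Matrix.mulVec_zero, Matrix.mulVec_zero, Pi.zero_apply, Pi.zero_apply, add_zero, zero_add]
    refine (intervalIntegral.integral_congr fun r hr => ?_).trans intervalIntegral.integral_zero
    rw [uIcc_of_le hp0] at hr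
    simp only [h1 (t - p + r) (by linarith [hr.1]), hw (t - p + r) (by linarith [hr.1]),
      Matrix.mulVec_zero, Pi.zero_apply, add_zero]

variable (κ) in
/-- Exponential stability of the closed loop for vanishing reference and downstream signal. -/
lemma exists_exponential_bound (hi : i < S.N) :
    ∃ C : ℝ, 0 < C ∧ ∀ (t₀ T : ℝ) (U : ℝ → Fin (S.n i) → ℝ)
      (w : ℝ → Fin (S.m (i + 1)) → ℝ) (z γ : ℝ → ℝ → S.Idx i → ℝ),
      κ.IsTrajectory i t₀ U w z γ → S.tr i ≤ t₀ → t₀ ≤ T → (∀ t, 0 ≤ t → w t = 0) →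
      (∀ t, T < t → ∀ j, γ t 0 (Sum.inl j) = 0) →
      (∀ t, T + S.tr i + S.tl i < t → ∀ x ∈ Icc (0 : ℝ) 1, γ t x = 0) →
      ∀ t, T ≤ t → normL2 γ t ≤ C * Real.exp (-1 * (t - T)) * normL2 γ T := by
  set L := S.tr i + S.tl i with hL
  obtain ⟨C, hC, hCb⟩ := κ.exists_trajectory_sqInt_bound hi L
  -- On the window `t - T ≤ L` the factor `exp L` compensates the decay at rate 1, and afterwards
  -- the state is zero. The summand 1 only ensures positivity.
  refine ⟨Real.sqrt C.toReal * Real.exp L + 1, by positivity, ?_⟩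
  intro t₀ T U w z γ h ht₀ hT hw h0 hzero t ht
  have hN0 : ∀ t, 0 ≤ normL2 γ t := fun t => Real.sqrt_nonneg _
  rcases le_or_gt t (T + L) with htL | htL
  · have h1 := hCb t₀ T U w z γ h ht₀ hT hw h0 t ⟨ht, htL⟩
    rw [← h.ofReal_normL2_sq (hT.trans ht), ← h.ofReal_normL2_sq hT, ← ENNReal.ofReal_toReal hC,
      ← ENNReal.ofReal_mul ENNReal.toReal_nonneg,
      ENNReal.ofReal_le_ofReal_iff (by positivity)] at h1
    have h2 : normL2 γ t ≤ Real.sqrt C.toReal * normL2 γ T := by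
      have := Real.sqrt_le_sqrt h1
      rwa [Real.sqrt_sq (hN0 t), Real.sqrt_mul ENNReal.toReal_nonneg, Real.sqrt_sq (hN0 T)] at this
    refine h2.trans (mul_le_mul_of_nonneg_right ?_ (hN0 T))
    have h3 : 1 ≤ Real.exp L * Real.exp (-1 * (t - T)) := by
      rw [← Real.exp_add]
      exact Real.one_le_exp (by linarith)
    have h4 := mul_le_mul_of_nonneg_left h3 (Real.sqrt_nonneg C.toReal)
    have h5 := Real.exp_pos (-1 * (t - T))
    nlinarith
  · have : normL2 γ t = 0 := by
      rw [normL2, Real.sqrt_eq_zero']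
      refine le_of_eq (Finset.sum_eq_zero fun c _ => ?_)
      refine (intervalIntegral.integral_congr fun x hx => ?_).trans intervalIntegral.integral_zero
      rw [uIcc_of_le zero_le_one] at hx
      simp [hzero t (by linarith) x hx]
    rw [this]
    have := hN0 T
    positivity

end Chain.Kernels

end HypChain

end

theorem mainTheorem3 (S : HypChain.Chain) (κ : S.Kernels) (i : ℕ) (hi : i + 1 < S.N) :
    ∃ L : HypChain.ControlLaw S i,
      -- switching the law on at any time, from any trajectory, gives a closed-loop trajectory
      (∀ (t₀ : ℝ), S.tr i ≤ t₀ → S.memory i ≤ t₀ →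
        ∀ (ζ : ℝ → Fin (S.n i) → ℝ), HypChain.IsH1 ζ →
        ∀ (w : ℝ → Fin (S.m (i + 1)) → ℝ) (U : ℝ → Fin (S.n i) → ℝ)
          (z γ : ℝ → ℝ → S.Idx i → ℝ), κ.IsTrajectory i t₀ U w z γ →
        ∃ (U' : ℝ → Fin (S.n i) → ℝ) (z' γ' : ℝ → ℝ → S.Idx i → ℝ),
          κ.IsTrajectory i t₀ U' w z' γ' ∧
          (∀ t, t ≤ t₀ + S.memory i → U' t = U t) ∧
          (∀ t, t ≤ t₀ + S.memory i + S.delay i → ∀ x ∈ Set.Icc (0 : ℝ) 1,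
            z' t x = z t x ∧ γ' t x = γ t x) ∧
          L.Drives (t₀ + S.memory i) ζ
            (fun t x => z' (t + S.delay i) x) (fun t x => γ' (t + S.delay i) x) U') ∧
      -- tracking in finite time
      (∀ (t₀ : ℝ), S.tr i ≤ t₀ → S.memory i ≤ t₀ →
        ∀ (ζ : ℝ → Fin (S.n i) → ℝ), HypChain.IsH1 ζ →
        ∀ (w : ℝ → Fin (S.m (i + 1)) → ℝ) (U : ℝ → Fin (S.n i) → ℝ)
          (z γ Pz Pγ : ℝ → ℝ → S.Idx i → ℝ), κ.IsTrajectory i t₀ U w z γ →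
        HypChain.IsPrediction (S.delay i) t₀ Pz z →
        HypChain.IsPrediction (S.delay i) t₀ Pγ γ →
        L.Drives (t₀ + S.memory i) ζ Pz Pγ U →
        ∀ t, t₀ + S.memory i + S.delay i + S.tr i < t →
          ∀ j, γ t 1 (Sum.inl j) = ζ t j) ∧
      -- exponential and finite-time stabilization when the reference and `v_{i+1}(·,0)` vanish
      (∃ C ν : ℝ, 0 < C ∧ 0 < ν ∧
        ∀ (t₀ : ℝ), S.tr i ≤ t₀ → S.memory i ≤ t₀ →
        ∀ (ζ : ℝ → Fin (S.n i) → ℝ), (∀ t, 0 ≤ t → ζ t = 0) →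
        ∀ (w : ℝ → Fin (S.m (i + 1)) → ℝ), (∀ t, 0 ≤ t → w t = 0) →
        ∀ (U : ℝ → Fin (S.n i) → ℝ) (z γ Pz Pγ : ℝ → ℝ → S.Idx i → ℝ),
        κ.IsTrajectory i t₀ U w z γ →
        HypChain.IsPrediction (S.delay i) t₀ Pz z →
        HypChain.IsPrediction (S.delay i) t₀ Pγ γ →
        L.Drives (t₀ + S.memory i) ζ Pz Pγ U →
        (∀ t, t₀ + S.memory i + S.delay i ≤ t →
          HypChain.normL2 γ t ≤ C * Real.exp (-ν * (t - (t₀ + S.memory i + S.delay i)))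
            * HypChain.normL2 γ (t₀ + S.memory i + S.delay i)) ∧
        (∀ t, t₀ + S.memory i + S.delay i + S.tr i + S.tl i < t →
          ∀ x ∈ Set.Icc (0 : ℝ) 1, γ t x = 0)) := by
  have hi' : i < S.N := by omega
  have htr := HypChain.Chain.tr_pos (S := S) (i := i) hi'
  have hm := HypChain.Chain.memory_nonneg (S := S) (i := i) hi'
  have hd := HypChain.Chain.delay_nonneg (S := S) (i := i) hi'
  obtain ⟨C, hC0, hC⟩ := κ.exists_exponential_bound hi'
  refine ⟨κ.controlLaw hi', ?_, ?_, C, 1, hC0, one_pos, ?_⟩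
  · intro t₀ ht₀ _ ζ hζ w U z γ h
    exact h.exists_closedLoop hi hi' ht₀ hζ.cont
  · intro t₀ ht₀ _ ζ hζ w U z γ Pz Pγ h hPz _ hU t ht j
    obtain ⟨d, hdζ, hdm, hdb⟩ := HypChain.exists_extension_of_continuousOn hζ.cont
    rw [h.eq_triSolve hi' (by linarith) hPz hU hdζ hdm hdb j ⟨zero_le_one, le_rfl⟩ (by linarith),
      HypChain.triSolve_anchor, hdζ t (by linarith)]
  · intro t₀ ht₀ _ ζ hζ w hw U z γ Pz Pγ h hPz _ hU
    have hα : ∀ t, ∀ x ∈ Set.Icc (0 : ℝ) 1,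
        t₀ + S.memory i + S.delay i < t - x * S.tr i → ∀ k, γ t x (Sum.inl k) = 0 := by
      intro t x hx ht k
      -- The reference vanishes only at nonnegative times, so the zero function takes its place as
      -- data for `triSolve`.
      rw [h.eq_triSolve hi' (by linarith) hPz hU (d := 0) (fun t ht => (hζ t ht).symm)
        (fun _ => measurable_const) (fun R => ⟨0, fun t k _ => by simp⟩) k hx ht]
      exact HypChain.triSolve_zero (fun t => rfl) k t x
    have hT : t₀ ≤ t₀ + S.memory i + S.delay i := by linarith
    have hzero : ∀ t, t₀ + S.memory i + S.delay i + S.tr i + S.tl i < t →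
        ∀ x ∈ Set.Icc (0 : ℝ) 1, γ t x = 0 :=
      fun t ht x hx => h.eq_zero hi' ht₀ hT hw hα ht hx
    refine ⟨fun t ht => hC t₀ _ U w z γ h ht₀ hT hw (fun t ht j => ?_) hzero t ht, hzero⟩
    exact hα t 0 ⟨le_rfl, zero_le_one⟩ (by simpa using ht) j
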